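/- **Setting.** Let $x_u\ne x_b$ be points of $\mathbb R^2$ (user and base station), $L=\|x_b-x_u\|$, and $H_d>H_b$, $H_d>H_u$ heights (of UAV, base station, user). The plane is partitioned into $\mathcal D_1,\dots,\mathcal D_K$ with $x_u\in\mathcal D_1$, which are *nested*: if $x\in\mathcal D_k$ and $0\le s\le1$ then $x_u+s(x-x_u)\in\mathcal D_j$ for some $j\le k$. Put $\tilde{\mathcal D}_k=\mathcal D_1\cup\dots\cup\mathcal D_k$. With $d_u(x)=\sqrt{\|x-x_u\|^2+(H_d-H_u)^2}$, $d_b(x)=\sqrt{\|x-x_b\|^2+(H_d-H_b)^2}$, exponents $\alpha_k>1$ and $\beta_k>0$ ($0\le k\le K$), let $g_b=\beta_0d_b^{-\alpha_0}$, $g_u^{(k)}=\beta_kd_u^{-\alpha_k}$, where $g_u^{(k)}<g_u^{(k-1)}$ on $\mathbb R^2$ for $2\le k\le K$, and $g_u=\sum_{k=1}^Kg_u^{(k)}\mathbb I\{x\in\mathcal D_k\}$. For a cost $f$ on $(0,\infty)^2$, problem $\mathscr P$ is to minimize $f(g_u(x),g_b(x))$ over $x\in\mathbb R^2$; its segment costs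 are $\Phi_k(x)=f(g_u^{(k)}(x),g_b(x))$. Let $x(\rho,\theta)=x_u+\rho M(\theta)\frac{x_b-x_u}{L}$, where $M(\theta)$ is the rotation by $\theta$, and $F_k(\rho,\theta)=\Phi_k(x(\rho,\theta))$. Partial derivatives of $F_k$ are taken from the left. **Algorithm** (continuous-time Shaded-Contour-Exploration, speed $\kappa>0$). For $k<K$ let $\rho_k^0$ minimize $F_k(\rho,0)$ over $\rho\ge0$ with $x(\rho,0)\in\tilde{\mathcal D}_k$ (these minimizers are supposed to exist); let $\rho_K^0$ minimize $F_K(\rho,0)$ over $\rho\ge 0$ with $x(\rho,0)\in\mathcal D_K$, if a minimizer exists. For $k=1,\dots,K-1$ in turn, follow a right branch ($\sigma=1$) and then a left branch ($\sigma=-1$). Each branch is a path $(\rho(t),\theta(t))$, Lipschitz in $t$, with start $(\rho_k^0,0)$. It ends when first $\rho\ge L\cos\theta$ or $\partial F_k/\partial\rho\ge0$. Until then: * as long as the ray from the current position away from the user stays in $\tilde{\mathcal D}_k$, the UAV moves along it with speed $\kappa$; * outside the closure of $\tilde{\mathcal D}_k$ it moves with speed $\kappa$ along the contour of $F_k$,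 i.e. $\frac{\partial F_k}{\partial\rho}\dot\rho+\frac{\partial F_k}{\partial\theta}\dot\theta=0$, with $\dot\rho\ge0$, $\sigma\dot\theta\ge0$ (for almost every $t$); * for almost every $t$ the velocity is a convex combination of these two velocities (so where the two regimes meet, solutions are understood in the sense of differential inclusions). Finally, the position $x(\rho_K^0,0)$ is visited if $\rho_K^0$ exists. $F_{\min}(t)$ is the least cost among the positions visited up to time $t$, and $\hat x(t)$ is any visited position that attains it. **Theorem.** (a) Suppose that $\mathscr P$ has an optimal solution and that $f$ satisfies one of the following. * *Condition 1:* $f$ is $C^2$ and strictly decreasing in each variable on $(0,\infty)^2$, and $f_{xy}=0$, $xf_{xx}+2f_x\ge0$, $yf_{yy}+2f_y\ge0$ for all $x,y>0$. * *Condition 2:* $f(x,y)=\max\{f_1(x),f_2(y)\}$ for all $x,y>0$, where $f_1,f_2$ are differentiable on $(0,\infty)$ with $f_1'<0$, $f_2'<0$. Then for every run of the algorithm the search ends in finite time, and there is a finite $t_0$ such that for all $t\ge t_0$ a best-so-far position $\hat x(t)$ exists, every such $\hat x(t)$ is a globally optimal solution to $\mathscr P$, and $F_{\min}(t)$ is the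 global minimum of $\mathscr P$. (b) (General form in polar coordinates.) Let $x_u$, $x_b$, $\mathcal D_1,\dots,\mathcal D_K$ be as above, and let $\Phi_1\le\dots\le\Phi_K$ now be arbitrary $C^1$ functions on $\mathbb R^2$. Suppose that, for every $k$: * for $|\theta|<\pi/2$, the function $F_k(\cdot,\theta)$ on $[0,\infty)$ has exactly one local minimizer and no stationary point elsewhere; * for $\rho>0$ and $0<|\theta|<\pi/2$, $\partial F_k/\partial|\theta|>0$. Suppose also that $\sum_k\Phi_k\mathbb I\{x\in\mathcal D_k\}$ has a global minimizer $x(\rho,\theta)$ with $0\le\rho\le L\cos\theta$, $|\theta|\le\pi/2$. Then the conclusion of (a) holds for the algorithm with these $\Phi_k$ and for the minimization of $\sum_k\Phi_k\mathbb I\{x\in\mathcal D_k\}$. -/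

import Mathlib

open Set MeasureTheory

noncomputable section

namespace UAV

/-- The horizontal plane, with the Euclidean norm. -/
abbrev Plane : Type := EuclideanSpace ℝ (Fin 2)

/-- Horizontal positions of the user and of the base station, and a partition of the plane into
`K` nested propagation segments `D_k = {x | seg x = k}`, `k = 1, …, K`. -/
structure Terrain where
  K : ℕ
  xu : Plane
  xb : Plane
  seg : Plane → ℕ
  xu_ne_xb : xu ≠ xb
  seg_mem : ∀ x, 1 ≤ seg x ∧ seg x ≤ K
  /-- there is line of sight on top of the user -/
  seg_user : seg xu = 1
  /-- moving towards the user never increases the degree of obstruction -/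
  nested : ∀ x : Plane, ∀ s : ℝ, 0 ≤ s → s ≤ 1 → seg (xu + s • (x - xu)) ≤ seg x

namespace Terrain

variable (T : Terrain)

/-- The horizontal distance between the base station and the user. -/
def L : ℝ := ‖T.xb - T.xu‖

/-- The unit vector pointing from the user to the base station. -/
def u : Plane := T.L⁻¹ • (T.xb - T.xu)

/-- The position with polar coordinates `(ρ, θ)`: distance `ρ` from the user, deviation angle `θ`
from the user-to-base-station direction. -/
def pos (ρ θ : ℝ) : Plane :=
  T.xu + ρ • !₂[Real.cos θ * T.u 0 - Real.sin θ * T.u 1, Real.sin θ * T.u 0 + Real.cos θ * T.u 1]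

/-- The virtual line-of-sight region `D_1 ∪ … ∪ D_k`. -/
def virtualLOS (k : ℕ) : Set Plane := {x | T.seg x ≤ k}

end Terrain

/-- The parameters of the propagation model. Index `0` is the link between the UAV and the base
station, index `k = 1, …, K` the link between the UAV and the user in the `k`-th segment. -/
structure Channel (T : Terrain) where
  Hd : ℝ
  Hb : ℝ
  Hu : ℝ
  α : ℕ → ℝ
  β : ℕ → ℝ
  Hb_lt : Hb < Hd
  Hu_lt : Hu < Hd
  one_lt_α : ∀ k, k ≤ T.K → 1 < α k
  β_pos : ∀ k, k ≤ T.K → 0 < β k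
  /-- a higher segment is more obstructed -/
  order : ∀ k, 2 ≤ k → k ≤ T.K → ∀ x : Plane,
    β k * Real.sqrt (‖x - T.xu‖ ^ 2 + (Hd - Hu) ^ 2) ^ (-α k) <
      β (k - 1) * Real.sqrt (‖x - T.xu‖ ^ 2 + (Hd - Hu) ^ 2) ^ (-α (k - 1))

namespace Channel

variable {T : Terrain} (C : Channel T)

/-- The distance between the UAV and the user. -/
def du (x : Plane) : ℝ := Real.sqrt (‖x - T.xu‖ ^ 2 + (C.Hd - C.Hu) ^ 2)

/-- The distance between the UAV and the base station. -/
def db (x : Plane) : ℝ := Real.sqrt (‖x - T.xb‖ ^ 2 + (C.Hd - C.Hb) ^ 2)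

/-- The channel gain between the UAV and the base station. -/
def gb (x : Plane) : ℝ := C.β 0 * C.db x ^ (-C.α 0)

/-- The channel gain between the UAV and the user, as if the UAV were in the `k`-th segment. -/
def guSeg (k : ℕ) (x : Plane) : ℝ := C.β k * C.du x ^ (-C.α k)

/-- The channel gain between the UAV and the user. -/
def gu (x : Plane) : ℝ := ∑ k ∈ Finset.Icc 1 T.K, if T.seg x = k then C.guSeg k x else 0

/-- The objective of the positioning problem. -/
def cost (f : ℝ → ℝ → ℝ) (x : Plane) : ℝ := f (C.gu x) (C.gb x)

/-- The fictitious cost of the `k`-th segment. -/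
def segCost (f : ℝ → ℝ → ℝ) (k : ℕ) (x : Plane) : ℝ := f (C.guSeg k x) (C.gb x)

end Channel

/-- First admissible class of cost functions: smooth, decreasing in each variable, with vanishing
mixed derivative and `x f_xx + 2 f_x ≥ 0`, `y f_yy + 2 f_y ≥ 0` for all `x, y > 0`. -/
def Condition1 (f : ℝ → ℝ → ℝ) : Prop :=
  ContDiffOn ℝ 2 (fun p : ℝ × ℝ => f p.1 p.2) (Ioi 0 ×ˢ Ioi 0) ∧
  (∀ y, 0 < y → StrictAntiOn (fun x => f x y) (Ioi 0)) ∧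
  (∀ x, 0 < x → StrictAntiOn (fun y => f x y) (Ioi 0)) ∧
  ∀ x y, 0 < x → 0 < y →
    deriv (fun y' => deriv (fun x' => f x' y') x) y = 0 ∧
    0 ≤ x * deriv (deriv fun x' => f x' y) x + 2 * deriv (fun x' => f x' y) x ∧
    0 ≤ y * deriv (deriv fun y' => f x y') y + 2 * deriv (fun y' => f x y') y

/-- Second admissible class of cost functions: `f(x, y) = max {f₁(x), f₂(y)}` with `f₁` and `f₂`
differentiable and decreasing (with negative derivative) on the positive half-line. -/
def Condition2 (f : ℝ → ℝ → ℝ) : Prop :=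
  ∃ f₁ f₂ : ℝ → ℝ,
    (∀ x, 0 < x → DifferentiableAt ℝ f₁ x ∧ deriv f₁ x < 0) ∧
    (∀ y, 0 < y → DifferentiableAt ℝ f₂ y ∧ deriv f₂ y < 0) ∧
    ∀ x y, 0 < x → 0 < y → f x y = max (f₁ x) (f₂ y)

/-! The algorithm, for arbitrary segment costs `Φ k : Plane → ℝ`, `k = 1, …, K`. -/

namespace Terrain

variable (T : Terrain) (Φ : ℕ → Plane → ℝ)

/-- The segment cost in polar coordinates. -/
def F (k : ℕ) (ρ θ : ℝ) : ℝ := Φ k (T.pos ρ θ)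

/-- The cost assembled from the segment costs. -/
def total (x : Plane) : ℝ := ∑ k ∈ Finset.Icc 1 T.K, if T.seg x = k then Φ k x else 0

/-- The partial derivative `∂F_k/∂ρ`, taken from the left. -/
def Fρ (k : ℕ) (ρ θ : ℝ) : ℝ := derivWithin (fun r => T.F Φ k r θ) (Iic ρ) ρ

/-- The partial derivative `∂F_k/∂θ`, taken from the left. -/
def Fθ (k : ℕ) (ρ θ : ℝ) : ℝ := derivWithin (fun t => T.F Φ k ρ t) (Iic θ) θ

/-- `ρ₀` minimizes `F_k(·, 0)` over the part of the axis in `D_1 ∪ … ∪ D_k`. -/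
def IsCritical (k : ℕ) (ρ₀ : ℝ) : Prop :=
  0 ≤ ρ₀ ∧ T.pos ρ₀ 0 ∈ T.virtualLOS k ∧
    ∀ ρ, 0 ≤ ρ → T.pos ρ 0 ∈ T.virtualLOS k → T.F Φ k ρ₀ 0 ≤ T.F Φ k ρ 0

/-- `ρ₀` minimizes `F_K(·, 0)` over the part of the axis in the last segment `D_K`. -/
def IsLastCritical (ρ₀ : ℝ) : Prop :=
  0 ≤ ρ₀ ∧ T.seg (T.pos ρ₀ 0) = T.K ∧
    ∀ ρ, 0 ≤ ρ → T.seg (T.pos ρ 0) = T.K → T.F Φ T.K ρ₀ 0 ≤ T.F Φ T.K ρ 0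

/-- The two stopping criteria of the `k`-th search. -/
def Stop (k : ℕ) (ρ θ : ℝ) : Prop := T.L * Real.cos θ ≤ ρ ∨ 0 ≤ T.Fρ Φ k ρ θ

/-- The polar velocities `(ρ', θ')` at `(ρ, θ)` of a motion along the contour of `F_k` with speed
`κ`, away from the user, with `|θ|` increasing on the right (`σ = 1`) or left (`σ = -1`) branch. If
`ρ > 0`, `∂F_k/∂ρ < 0` and `σ ∂F_k/∂θ > 0`, this is the single vector `γ (1, -(∂F_k/∂θ)⁻¹ ∂F_k/∂ρ)`,
where `γ > 0` gives it the speed `κ`; if `∂F_k/∂θ = 0`, as on the axis, it is `(0, σ κ / ρ)`. -/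
def contourVel (κ : ℝ) (k : ℕ) (σ : ℝ) (ρ θ : ℝ) : Set (ℝ × ℝ) :=
  {w | 0 ≤ w.1 ∧ 0 ≤ σ * w.2 ∧ T.Fρ Φ k ρ θ * w.1 + T.Fθ Φ k ρ θ * w.2 = 0 ∧
    w.1 ^ 2 + (ρ * w.2) ^ 2 = κ ^ 2}

/-- `(r, φ)` is a continuous-time trajectory, in polar coordinates, of one branch of the `k`-th
search, until the first time at which a stopping criterion holds; the later values are irrelevant.
In the virtual line-of-sight region the UAV moves radially away from the user with speed `κ`;
outside (of its closure) it follows the contour of `F_k` with speed `κ`. Where the two regimes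
meet, the velocity is a convex combination of the two, as usual for differential equations with
a discontinuous right-hand side. -/
structure IsBranch (κ : ℝ) (k : ℕ) (σ : ℝ) (ρ₀ : ℝ) (r φ : ℝ → ℝ) : Prop where
  r_init : r 0 = ρ₀
  φ_init : φ 0 = 0
  r_lipschitz : ∃ c, LipschitzOnWith c r (Ici 0)
  φ_lipschitz : ∃ c, LipschitzOnWith c φ (Ici 0)
  radial : ∀ t s : ℝ, 0 ≤ t → 0 ≤ s → (∀ τ, 0 ≤ τ → τ < t + s → ¬ T.Stop Φ k (r τ) (φ τ)) →
    T.pos (r t) (φ t) ∈ T.virtualLOS k → T.pos (r t + κ * s) (φ t) ∈ T.virtualLOS k →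
    r (t + s) = r t + κ * s ∧ φ (t + s) = φ t
  flow : ∀ᵐ t : ℝ, 0 ≤ t → (∀ τ, 0 ≤ τ → τ ≤ t → ¬ T.Stop Φ k (r τ) (φ τ)) →
    ∃ w ∈ convexHull ℝ (insert (κ, 0) (T.contourVel Φ κ k σ (r t) (φ t))),
      HasDerivAt r w.1 t ∧ HasDerivAt φ w.2 t ∧
      (T.pos (r t) (φ t) ∉ closure (T.virtualLOS k) →
        w ∈ T.contourVel Φ κ k σ (r t) (φ t))

/-- The index `k` of the search to which the `i`-th branch belongs: branches `0, 1` are the right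
and left branches of the first search, branches `2, 3` those of the second one, and so on. -/
def branchIndex (i : ℕ) : ℕ := i / 2 + 1

/-- The side of the `i`-th branch: `1` for right, `-1` for left. -/
def branchSide (i : ℕ) : ℝ := if i % 2 = 0 then 1 else -1

end Terrain

/-- The data of a run: the critical distances `ρ_k⁰` on the axis, and the polar trajectories of the
branches, each in its own time starting at `0`. -/
structure Run where
  ρ₀ : ℕ → ℝ
  r : ℕ → ℝ → ℝ
  φ : ℕ → ℝ → ℝ

/-- `R` is a run of the continuous-time algorithm with speed `κ`. It consists of the `2 (K - 1)`
branches, and of the last critical position if there is one. -/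
structure Run.IsValid (R : Run) (T : Terrain) (Φ : ℕ → Plane → ℝ) (κ : ℝ) : Prop where
  critical : ∀ k, 1 ≤ k → k < T.K → T.IsCritical Φ k (R.ρ₀ k)
  lastCritical : (∃ ρ, T.IsLastCritical Φ ρ) → T.IsLastCritical Φ (R.ρ₀ T.K)
  branch : ∀ i, i < 2 * (T.K - 1) →
    T.IsBranch Φ κ (Terrain.branchIndex i) (Terrain.branchSide i)
      (R.ρ₀ (Terrain.branchIndex i)) (R.r i) (R.φ i)

namespace Run

variable (R : Run) (T : Terrain) (Φ : ℕ → Plane → ℝ)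

/-- The duration of the `i`-th branch: the first time at which a stopping criterion holds
(`∞` if there is none). -/
def duration (i : ℕ) : ENNReal :=
  sInf (ENNReal.ofReal ''
    {t : ℝ | 0 ≤ t ∧ T.Stop Φ (Terrain.branchIndex i) (R.r i t) (R.φ i t)})

/-- The time at which the `i`-th branch starts. -/
def start (i : ℕ) : ENNReal := ∑ j ∈ Finset.range i, R.duration T Φ j

/-- The positions on the search trajectory up to time `t`. -/
def visited (t : ℝ) : Set Plane :=
  {x | (∃ i < 2 * (T.K - 1), ∃ τ : ℝ, 0 ≤ τ ∧ ENNReal.ofReal τ ≤ R.duration T Φ i ∧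
        R.start T Φ i + ENNReal.ofReal τ ≤ ENNReal.ofReal t ∧
        x = T.pos (R.r i τ) (R.φ i τ)) ∨
      (R.start T Φ (2 * (T.K - 1)) ≤ ENNReal.ofReal t ∧ T.IsLastCritical Φ (R.ρ₀ T.K) ∧
        x = T.pos (R.ρ₀ T.K) 0)}

/-- The minimum cost `F_min(t)` found up to time `t`, for the objective `J`. -/
def Fmin (J : Plane → ℝ) (t : ℝ) : ℝ := sInf (J '' R.visited T Φ t)

/-- `x` can be the best-so-far position at time `t`: it has the least cost among the positions
visited up to time `t`. -/
def IsBest (J : Plane → ℝ) (t : ℝ) (x : Plane) : Prop :=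
  x ∈ R.visited T Φ t ∧ ∀ y ∈ R.visited T Φ t, J x ≤ J y

/-- The search ends in finite time; and from a finite time on, there is a best-so-far position,
every such position is a global minimizer of `J`, and `F_min(t)` is the minimum of `J`. -/
def ReachesOptimum (J : Plane → ℝ) : Prop :=
  R.start T Φ (2 * (T.K - 1)) < ⊤ ∧
  ∃ t₀ : ℝ, 0 ≤ t₀ ∧ ∀ t, t₀ ≤ t →
    (∃ x, R.IsBest T Φ J t x) ∧
    (∀ x, R.IsBest T Φ J t x → ∀ y, J x ≤ J y) ∧
    IsLeast (range J) (R.Fmin T Φ J t)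

end Run

/-- Unique radial minimizer: for `|θ| < π/2`, the function `F_k(·, θ)` on `ρ ≥ 0` has exactly one
local minimizer, and no stationary point elsewhere. -/
def UniqueRadialMin (T : Terrain) (Φ : ℕ → Plane → ℝ) (k : ℕ) : Prop :=
  ∀ θ, |θ| < Real.pi / 2 → ∃ ρs, 0 ≤ ρs ∧ ∀ ρ, 0 ≤ ρ →
    (IsLocalMinOn (fun r => T.F Φ k r θ) (Ici 0) ρ ↔ ρ = ρs) ∧
    (ρ ≠ ρs → T.Fρ Φ k ρ θ ≠ 0)

/-- Angular monotonicity: `F_k` has positive derivative with respect to `|θ|` off the axis. -/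
def AngularMono (T : Terrain) (Φ : ℕ → Plane → ℝ) (k : ℕ) : Prop :=
  ∀ ρ θ, 0 < ρ → |θ| < Real.pi / 2 →
    (0 < θ → 0 < T.Fθ Φ k ρ θ) ∧ (θ < 0 → T.Fθ Φ k ρ θ < 0)

end UAV

end

noncomputable section

open Set MeasureTheory Filter Topology

/-! ### Monotonicity along Lipschitz paths -/

namespace UAV

/-! Take a global minimizer at polar position `(ρs, σ ψ)` in segment `k`. By the ordering of the
segment costs, `Φ k` dominates the true cost on the virtual line-of-sight region, so the optimal
value bounds `Φ k` from below there and it is enough to visit a point of that region where `Φ k` is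
no larger than this value. If `k = K`, turning the minimizer onto the axis does not raise the cost,
and the last critical position is optimal. If `k < K`, branch `σ` of search `k` does the work
(`IsBranch.exists_visit`).

Along that branch radius and angle never decrease, and `r + L σ φ` grows at rate at least `κ` while
staying bounded, so the branch ends. It never falls below the optimal value: in the closure of the
virtual line-of-sight region this is continuity, and outside it the motion along contours does not
lower the cost (`IsBranch.le_cost`). This barrier traps the path. It cannot cross the radius `ρs` at
an angle below `ψ`, where the cost would be strictly smaller than optimal; and it cannot stop at an
angle at most `ψ` and a radius below `ρs`, because the cost would increase radially from there to
`ρs`, again making the stopping point better than optimal. Hence the path reaches angle `ψ`. If its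
radius is then at most `ρs`, nestedness puts the rest of the ray up to the target in the virtual
line-of-sight region and the radial motion runs into the target. If the radius is already larger,
monotonicity of the angle shows that the target has been passed.

The argument uses only the properties collected in `IsRegular`, with a closed set `E` containing the
running path and a `C¹` function `G` that orders the cost on `E`. For `C¹` costs, `E` is the plane
and `G` is the cost itself. Under Condition 1 the cost splits into a sum, and its radial derivative
is strictly increasing up to `L cos θ`. Under Condition 2 the search runs only where the station's
term is active, and `G` is minus the station's gain: the cost has kinks and `f₂` need not be `C¹`,
but this gain is smooth. -/

/-- A function that is absolutely continuous on `[a, b]` and has a nonnegative derivative almost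
everywhere does not decrease from `a` to `b`. -/
lemma le_of_ae_hasDerivAt_nonneg {f : ℝ → ℝ} {a b : ℝ} (hab : a ≤ b)
    (hf : AbsolutelyContinuousOnInterval f a b)
    (h : ∀ᵐ t : ℝ, a < t → t < b → ∃ d, 0 ≤ d ∧ HasDerivAt f d t) : f a ≤ f b := by
  have h1 := hf.integral_deriv_eq_sub
  have h2 : 0 ≤ ∫ x in a..b, deriv f x := by
    apply intervalIntegral.integral_nonneg_of_ae_restrict hab
    rw [← restrict_Ioo_eq_restrict_Icc]
    rw [Filter.EventuallyLE, ae_restrict_iff' measurableSet_Ioo]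
    filter_upwards [h] with t ht htm
    obtain ⟨d, hd, hd'⟩ := ht htm.1 htm.2
    rw [hd'.deriv]; exact hd
  linarith

/-- A `C¹` function of two Lipschitz functions is absolutely continuous. -/
lemma absolutelyContinuousOnInterval_comp_prod {H : ℝ × ℝ → ℝ} (hH : ContDiff ℝ 1 H)
    {r φ : ℝ → ℝ} {a b : ℝ} (ha : 0 ≤ a) (hab : a ≤ b)
    (hr : ∃ c, LipschitzOnWith c r (Ici 0)) (hφ : ∃ c, LipschitzOnWith c φ (Ici 0)) :
    AbsolutelyContinuousOnInterval (fun t => H (r t, φ t)) a b := by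
  obtain ⟨c, hc⟩ := hr
  obtain ⟨d, hd⟩ := hφ
  have hsub : Icc a b ⊆ Ici (0 : ℝ) := fun t ht => ha.trans ht.1
  have hγ : LipschitzOnWith (max c d) (fun t => (r t, φ t)) (Icc a b) :=
    (hc.mono hsub).prodMk (hd.mono hsub)
  have hcpt : IsCompact ((fun t => (r t, φ t)) '' Icc a b) :=
    isCompact_Icc.image_of_continuousOn hγ.continuousOn
  obtain ⟨e, he⟩ := (hH.locallyLipschitz.locallyLipschitzOn (s := (fun t => (r t, φ t)) '' Icc a b)
    ).exists_lipschitzOnWith_of_compact hcpt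
  have := he.comp hγ (mapsTo_image _ _)
  rw [← uIcc_of_le hab] at this
  exact this.absolutelyContinuousOnInterval

/-! ### Polar coordinates around the user -/

namespace Terrain

variable (T : Terrain)

lemma L_pos : 0 < T.L := norm_pos_iff.2 (sub_ne_zero.2 T.xu_ne_xb.symm)

/-- The unit vector `u` turned by a right angle. -/
def uPerp : Plane := !₂[-T.u 1, T.u 0]

lemma pos_eq (ρ θ : ℝ) :
    T.pos ρ θ = T.xu + ρ • (Real.cos θ • T.u + Real.sin θ • T.uPerp) := by
  unfold pos
  congr 2
  ext i
  fin_cases i <;> simp [uPerp] <;> ring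

lemma contDiff_pos {n : WithTop ℕ∞} : ContDiff ℝ n (fun p : ℝ × ℝ => T.pos p.1 p.2) := by
  simp only [pos_eq]
  fun_prop

lemma continuous_pos : Continuous (fun p : ℝ × ℝ => T.pos p.1 p.2) :=
  (T.contDiff_pos (n := 0)).continuous

lemma u_sq : T.u 0 ^ 2 + T.u 1 ^ 2 = 1 := by
  have h : ‖T.u‖ = 1 := by
    rw [u, norm_smul, norm_inv, Real.norm_of_nonneg T.L_pos.le]
    exact inv_mul_cancel₀ T.L_pos.ne'
  have := EuclideanSpace.norm_sq_eq T.u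
  rw [h] at this
  simpa [Fin.sum_univ_two] using this.symm

lemma xb_eq : T.xb = T.xu + T.L • T.u := by
  rw [u, smul_inv_smul₀ T.L_pos.ne']
  abel

lemma norm_pos_sub_xu (ρ θ : ℝ) : ‖T.pos ρ θ - T.xu‖ ^ 2 = ρ ^ 2 := by
  rw [EuclideanSpace.norm_sq_eq]
  have h1 := T.u_sq
  have h2 := Real.sin_sq_add_cos_sq θ
  simp [Fin.sum_univ_two, pos_eq, uPerp]
  linear_combination (ρ ^ 2 * (T.u 0 ^ 2 + T.u 1 ^ 2)) * h2 + ρ ^ 2 * h1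

/-- The law of cosines, split into the components of the base station along and across the ray. On a
fixed ray the across part is constant and acts as additional height, so the station's gain is again
a `gain` in one variable. -/
lemma norm_pos_sub_xb (ρ θ : ℝ) :
    ‖T.pos ρ θ - T.xb‖ ^ 2 = (T.L * Real.cos θ - ρ) ^ 2 + (T.L * Real.sin θ) ^ 2 := by
  rw [EuclideanSpace.norm_sq_eq]
  have h1 := T.u_sq
  have h2 := Real.sin_sq_add_cos_sq θ
  simp [Fin.sum_univ_two, pos_eq, uPerp, xb_eq]
  linear_combination (ρ ^ 2 * (T.u 0 ^ 2 + T.u 1 ^ 2) - T.L ^ 2) * h2 +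
    (ρ ^ 2 + T.L ^ 2 - 2 * ρ * T.L * Real.cos θ) * h1

@[simp] lemma pos_zero (θ : ℝ) : T.pos 0 θ = T.xu := by simp [pos_eq]

lemma seg_pos_mono {ρ ρ' : ℝ} (h0 : 0 ≤ ρ) (h : ρ ≤ ρ') (θ : ℝ) :
    T.seg (T.pos ρ θ) ≤ T.seg (T.pos ρ' θ) := by
  -- Nestedness is applied with ratio `ρ / ρ'`; radius `0` is treated apart because `ρ'` may then
  -- vanish too.
  rcases h0.eq_or_lt with rfl | h0
  · rw [pos_zero, T.seg_user]
    exact (T.seg_mem _).1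
  · have hρ' := h0.trans_le h
    have := T.nested (T.pos ρ' θ) (ρ / ρ') (by positivity) ((div_le_one hρ').2 h)
    convert this using 2
    simp only [pos_eq, add_sub_cancel_left, smul_smul]
    rw [div_mul_cancel₀ _ hρ'.ne']

lemma virtualLOS_of_le {k : ℕ} {ρ ρ' θ : ℝ} (h : T.pos ρ' θ ∈ T.virtualLOS k) (h0 : 0 ≤ ρ)
    (hρ : ρ ≤ ρ') : T.pos ρ θ ∈ T.virtualLOS k :=
  (T.seg_pos_mono h0 hρ θ).trans h

lemma exists_eq_pos (x : Plane) :
    ∃ ρ θ, 0 ≤ ρ ∧ -Real.pi < θ ∧ θ ≤ Real.pi ∧ x = T.pos ρ θ := by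
  set a := (x - T.xu) 0
  set b := (x - T.xu) 1
  -- The coordinates of `x - xu` in the orthonormal frame `u`, `uPerp`; the polar form of this
  -- complex number gives `ρ` and `θ`.
  let z : ℂ := ⟨a * T.u 0 + b * T.u 1, b * T.u 0 - a * T.u 1⟩
  refine ⟨‖z‖, z.arg, norm_nonneg _, Complex.neg_pi_lt_arg z, Complex.arg_le_pi z, ?_⟩
  have h1 := T.u_sq
  have hc : ‖z‖ * Real.cos z.arg = a * T.u 0 + b * T.u 1 := Complex.norm_mul_cos_arg z
  have hs : ‖z‖ * Real.sin z.arg = b * T.u 0 - a * T.u 1 := Complex.norm_mul_sin_arg z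
  have ha : x 0 = T.xu 0 + a := by simp [a]
  have hb : x 1 = T.xu 1 + b := by simp [b]
  rw [pos_eq]
  ext i
  fin_cases i <;> simp [uPerp]
  · linear_combination ha - a * h1 - T.u 0 * hc + T.u 1 * hs
  · linear_combination hb - b * h1 - T.u 1 * hc - T.u 0 * hs

lemma total_eq (Φ : ℕ → Plane → ℝ) (x : Plane) : T.total Φ x = Φ (T.seg x) x := by
  rw [total, Finset.sum_ite_eq]
  simp [T.seg_mem x]

end Terrain

/-! ### Abstract conditions on a segment cost -/

/-- What the search for the `k`-th segment needs from the segment cost. Wherever the search does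
not stop, the cost is an increasing function of the smooth function `G`, and increases with the
deviation angle; wherever the radial stopping criterion is met (in the limit), it increases with
the distance from the user, up to the circle with the diameter from the user to the base station. -/
structure IsRegular (T : Terrain) (Φ : ℕ → Plane → ℝ) (k : ℕ) (E : Set Plane) (G : Plane → ℝ) :
    Prop where
  continuous : Continuous (Φ k)
  isClosed : IsClosed E
  mem_of_running : ∀ ρ θ, 0 ≤ ρ → |θ| < Real.pi / 2 → ¬ T.Stop Φ k ρ θ → T.pos ρ θ ∈ E
  -- The end of a branch is an infimum of stopping times. Since `Fρ` may be discontinuous, the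
  -- criterion need not hold at that infimum, only at points arbitrarily close to it.
  strictMonoOn : ∀ ρ θ, 0 ≤ ρ → |θ| < Real.pi / 2 → ρ < T.L * Real.cos θ →
    (∃ᶠ p in 𝓝 (ρ, θ), 0 ≤ T.Fρ Φ k p.1 p.2) →
    StrictMonoOn (fun r => T.F Φ k r θ) (Icc ρ (T.L * Real.cos θ))
  angular_le : ∀ σ : ℝ, (σ = 1 ∨ σ = -1) → ∀ ρ ψ ψ', 0 ≤ ρ → 0 ≤ ψ → ψ ≤ ψ' →
    ψ' < Real.pi / 2 → T.F Φ k ρ (σ * ψ) ≤ T.F Φ k ρ (σ * ψ')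
  angular_lt : ∀ σ : ℝ, (σ = 1 ∨ σ = -1) → ∀ ρ ψ ψ', 0 < ρ → 0 ≤ ψ → ψ < ψ' →
    ψ' < Real.pi / 2 → T.pos ρ (σ * ψ) ∈ E → T.F Φ k ρ (σ * ψ) < T.F Φ k ρ (σ * ψ')
  contDiff : ContDiff ℝ 1 G
  le_of_le : ∀ x ∈ E, ∀ y ∈ E, G x ≤ G y → Φ k x ≤ Φ k y
  contour : ∀ κ σ : ℝ, (σ = 1 ∨ σ = -1) → ∀ ρ θ, 0 ≤ ρ → |θ| < Real.pi / 2 → 0 ≤ σ * θ →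
    ¬ T.Stop Φ k ρ θ → ∀ w ∈ T.contourVel Φ κ k σ ρ θ,
    0 ≤ fderiv ℝ (fun p : ℝ × ℝ => G (T.pos p.1 p.2)) (ρ, θ) w

/-! ### Dynamics of one branch -/

namespace Terrain

variable {T : Terrain} {Φ : ℕ → Plane → ℝ} {κ : ℝ} {k : ℕ} {σ : ℝ}

/-- The three inequalities cut out a convex set containing both admissible kinds of velocity; for
the contour velocities, the last one holds because the sum of two nonnegative numbers is at least
the root of the sum of their squares. It measures the progress that forces termination. -/
lemma nonneg_of_mem_convexHull (hκ : 0 ≤ κ) (hσ : σ = 1 ∨ σ = -1) {ρ θ : ℝ} (hρ : 0 ≤ ρ)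
    {w : ℝ × ℝ} (hw : w ∈ convexHull ℝ (insert (κ, 0) (T.contourVel Φ κ k σ ρ θ))) :
    0 ≤ w.1 ∧ 0 ≤ σ * w.2 ∧ κ ≤ w.1 + ρ * (σ * w.2) := by
  let S : Set (ℝ × ℝ) := {w | 0 ≤ w.1 ∧ 0 ≤ σ * w.2 ∧ κ ≤ w.1 + ρ * (σ * w.2)}
  have hS : Convex ℝ S := by
    rintro x ⟨hx1, hx2, hx3⟩ y ⟨hy1, hy2, hy3⟩ a b ha hb hab
    refine ⟨?_, ?_, ?_⟩
    · simp only [Prod.fst_add, Prod.smul_fst, smul_eq_mul]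
      positivity
    · simp only [Prod.snd_add, Prod.smul_snd, smul_eq_mul]
      have h1 := mul_nonneg ha hx2
      have h2 := mul_nonneg hb hy2
      linarith
    · simp only [Prod.fst_add, Prod.smul_fst, Prod.snd_add, Prod.smul_snd, smul_eq_mul]
      have h1 := mul_le_mul_of_nonneg_left hx3 ha
      have h2 := mul_le_mul_of_nonneg_left hy3 hb
      have h3 : a * κ + b * κ = κ := by rw [← add_mul, hab, one_mul]
      linarith
  have hsub : insert (κ, 0) (T.contourVel Φ κ k σ ρ θ) ⊆ S := by
    rintro v (rfl | ⟨h1, h2, -, h4⟩)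
    · exact ⟨hκ, by simp, by simp⟩
    · refine ⟨h1, h2, ?_⟩
      have hσ2 : σ ^ 2 = 1 := by rcases hσ with rfl | rfl <;> norm_num
      have h5 : 0 ≤ ρ * (σ * v.2) := mul_nonneg hρ h2
      refine le_of_sq_le_sq ?_ (by positivity)
      have : (ρ * v.2) ^ 2 = (ρ * (σ * v.2)) ^ 2 := by
        rw [mul_pow, mul_pow, mul_pow, hσ2, one_mul]
      nlinarith [mul_nonneg h1 h5]
  exact convexHull_min hsub hS hw

lemma abs_eq_of_sign (hσ : σ = 1 ∨ σ = -1) {θ : ℝ} (h : 0 ≤ σ * θ) : |θ| = σ * θ := by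
  rcases hσ with rfl | rfl
  · rw [one_mul] at *; exact abs_of_nonneg h
  · rw [neg_one_mul] at *; exact abs_of_nonpos (by linarith)

variable {ρ₀ : ℝ} {r φ : ℝ → ℝ}

namespace IsBranch

lemma r_continuousOn (hb : T.IsBranch Φ κ k σ ρ₀ r φ) : ContinuousOn r (Ici 0) :=
  hb.r_lipschitz.choose_spec.continuousOn

lemma φ_continuousOn (hb : T.IsBranch Φ κ k σ ρ₀ r φ) : ContinuousOn φ (Ici 0) :=
  hb.φ_lipschitz.choose_spec.continuousOn

lemma pos_continuousOn (hb : T.IsBranch Φ κ k σ ρ₀ r φ) :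
    ContinuousOn (fun t => T.pos (r t) (φ t)) (Ici 0) :=
  T.continuous_pos.comp_continuousOn (hb.r_continuousOn.prodMk hb.φ_continuousOn)

/-- Before the search stops, the distance from the user does not decrease. -/
lemma r_le (hb : T.IsBranch Φ κ k σ ρ₀ r φ) (hκ : 0 ≤ κ) {a b : ℝ} (ha : 0 ≤ a) (hab : a ≤ b)
    (hns : ∀ τ, 0 ≤ τ → τ < b → ¬ T.Stop Φ k (r τ) (φ τ)) : r a ≤ r b := by
  refine le_of_ae_hasDerivAt_nonneg hab
    (absolutelyContinuousOnInterval_comp_prod (H := Prod.fst) contDiff_fst ha hab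
      hb.r_lipschitz hb.φ_lipschitz) ?_
  filter_upwards [hb.flow] with t ht hat htb
  obtain ⟨w, hw, hr, -, -⟩ := ht (ha.trans hat.le) fun τ h1 h2 => hns τ h1 (h2.trans_lt htb)
  refine ⟨w.1, ?_, hr⟩
  have hsub : insert (κ, 0) (T.contourVel Φ κ k σ (r t) (φ t)) ⊆ {v : ℝ × ℝ | 0 ≤ v.1} := by
    rintro v (rfl | h)
    · exact hκ
    · exact h.1
  exact convexHull_min hsub (convex_halfSpace_ge (f := Prod.fst) ⟨fun _ _ => rfl, fun _ _ => rfl⟩ 0)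
    hw

lemma r_nonneg (hb : T.IsBranch Φ κ k σ ρ₀ r φ) (hκ : 0 ≤ κ) (h0 : 0 ≤ ρ₀) {t : ℝ} (ht : 0 ≤ t)
    (hns : ∀ τ, 0 ≤ τ → τ < t → ¬ T.Stop Φ k (r τ) (φ τ)) : 0 ≤ r t := by
  have := hb.r_le hκ le_rfl ht hns
  rw [hb.r_init] at this
  exact h0.trans this

/-- Before the search stops, the deviation angle does not decrease. -/
lemma φ_le (hb : T.IsBranch Φ κ k σ ρ₀ r φ) (hκ : 0 ≤ κ) (hσ : σ = 1 ∨ σ = -1)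
    (h0 : 0 ≤ ρ₀) {a b : ℝ} (ha : 0 ≤ a) (hab : a ≤ b)
    (hns : ∀ τ, 0 ≤ τ → τ < b → ¬ T.Stop Φ k (r τ) (φ τ)) : σ * φ a ≤ σ * φ b := by
  refine le_of_ae_hasDerivAt_nonneg (f := fun t => σ * φ t) hab
    (absolutelyContinuousOnInterval_comp_prod (H := fun p => σ * p.2)
      (contDiff_const.mul contDiff_snd) ha hab hb.r_lipschitz hb.φ_lipschitz) ?_
  filter_upwards [hb.flow] with t ht hat htb
  have h0t : 0 ≤ t := ha.trans hat.le
  obtain ⟨w, hw, -, hφ, -⟩ := ht h0t fun τ h1 h2 => hns τ h1 (h2.trans_lt htb)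
  have hrt := hb.r_nonneg hκ h0 h0t fun τ h1 h2 => hns τ h1 (h2.trans htb)
  exact ⟨σ * w.2, (nonneg_of_mem_convexHull hκ hσ hrt hw).2.1, hφ.const_mul σ⟩

lemma φ_nonneg (hb : T.IsBranch Φ κ k σ ρ₀ r φ) (hκ : 0 ≤ κ) (hσ : σ = 1 ∨ σ = -1)
    (h0 : 0 ≤ ρ₀) {t : ℝ} (ht : 0 ≤ t)
    (hns : ∀ τ, 0 ≤ τ → τ < t → ¬ T.Stop Φ k (r τ) (φ τ)) : 0 ≤ σ * φ t := by
  have := hb.φ_le hκ hσ h0 le_rfl ht hns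
  rwa [hb.φ_init, mul_zero] at this

/-- At angle `π / 2` the first stopping criterion reads `0 ≤ ρ`, so by continuity of the angle a
running branch cannot get there. -/
lemma φ_lt (hb : T.IsBranch Φ κ k σ ρ₀ r φ) (hκ : 0 ≤ κ) (hσ : σ = 1 ∨ σ = -1)
    (h0 : 0 ≤ ρ₀) {t : ℝ} (ht : 0 ≤ t)
    (hns : ∀ τ, 0 ≤ τ → τ ≤ t → ¬ T.Stop Φ k (r τ) (φ τ)) : σ * φ t < Real.pi / 2 := by
  by_contra! hcon
  have hc : ContinuousOn (fun t => σ * φ t) (Icc 0 t) :=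
    (continuousOn_const.mul hb.φ_continuousOn).mono fun s hs => hs.1
  have hmem : Real.pi / 2 ∈ Icc (σ * φ 0) (σ * φ t) := by
    rw [hb.φ_init, mul_zero]
    exact ⟨by positivity, hcon⟩
  obtain ⟨s, hs, hs'⟩ := intermediate_value_Icc ht hc hmem
  apply hns s hs.1 hs.2
  left
  have : Real.cos (φ s) = 0 := by
    simp only at hs'
    rcases hσ with rfl | rfl
    · rw [← Real.cos_pi_div_two, ← hs', one_mul]
    · rw [← Real.cos_neg, ← Real.cos_pi_div_two, ← hs', neg_one_mul]
  rw [this, mul_zero]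
  exact hb.r_nonneg hκ h0 hs.1 fun τ h1 h2 => hns τ h1 (h2.le.trans hs.2)

lemma abs_φ_lt (hb : T.IsBranch Φ κ k σ ρ₀ r φ) (hκ : 0 ≤ κ) (hσ : σ = 1 ∨ σ = -1)
    (h0 : 0 ≤ ρ₀) {t : ℝ} (ht : 0 ≤ t)
    (hns : ∀ τ, 0 ≤ τ → τ ≤ t → ¬ T.Stop Φ k (r τ) (φ τ)) : |φ t| < Real.pi / 2 := by
  rw [abs_eq_of_sign hσ (hb.φ_nonneg hκ hσ h0 ht fun τ h1 h2 => hns τ h1 h2.le)]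
  exact hb.φ_lt hκ hσ h0 ht hns

/-- Every branch ends in finite time. -/
lemma finite_duration (hb : T.IsBranch Φ κ k σ ρ₀ r φ) (hκ : 0 < κ) (hσ : σ = 1 ∨ σ = -1)
    (h0 : 0 ≤ ρ₀) : ∃ t, 0 ≤ t ∧ T.Stop Φ k (r t) (φ t) := by
  by_contra! hns
  have hL := T.L_pos
  have hrL : ∀ t, 0 ≤ t → r t < T.L := fun t ht => by
    have h1 := hns t ht
    simp only [Stop, not_or, not_le] at h1
    exact h1.1.trans_le (mul_le_of_le_one_right hL.le (Real.cos_le_one _))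
  -- The quantity `r + L σ φ` starts nonnegative, stays below `L + L π / 2` while running, and grows
  -- at rate at least `κ` since `r < L`; this is the time by which it would exceed its bound.
  set t := (T.L + T.L * (Real.pi / 2)) / κ with ht
  have ht0 : 0 ≤ t := by positivity
  have key := le_of_ae_hasDerivAt_nonneg (f := fun t => (r t + T.L * (σ * φ t)) - κ * t) ht0
    ((absolutelyContinuousOnInterval_comp_prod (H := fun p => p.1 + T.L * (σ * p.2)) (by fun_prop)
      le_rfl ht0 hb.r_lipschitz hb.φ_lipschitz).sub
      (ContDiffOn.absolutelyContinuousOnInterval (f := fun t : ℝ => κ * t)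
        (ContDiff.contDiffOn (by fun_prop)))) ?_
  · simp only [hb.r_init, hb.φ_init] at key
    have h1 := hrL t ht0
    have h2 := hb.φ_lt hκ.le hσ h0 ht0 fun τ h1 _ => hns τ h1
    have h3 : κ * t = T.L + T.L * (Real.pi / 2) := by rw [ht]; field_simp
    have h4 := mul_lt_mul_of_pos_left h2 hL
    rw [h3] at key
    linarith
  · filter_upwards [hb.flow] with s hs hs0 _
    obtain ⟨w, hw, hr, hφ, -⟩ := hs hs0.le fun τ h1 _ => hns τ h1
    have hrs := hb.r_nonneg hκ.le h0 hs0.le fun τ h1 _ => hns τ h1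
    obtain ⟨-, h2, h3⟩ := nonneg_of_mem_convexHull hκ.le hσ hrs hw
    refine ⟨_, ?_, (hr.add ((hφ.const_mul σ).const_mul T.L)).sub ((hasDerivAt_id s).const_mul κ)⟩
    have h4 := mul_le_mul_of_nonneg_right (hrL s hs0.le).le h2
    linarith

variable {E : Set Plane} {G : Plane → ℝ} {c : ℝ}

/-- The search trajectory does not fall below a lower bound of the segment cost in the virtual
line-of-sight region: outside of it, the cost does not decrease. -/
lemma le_cost (hb : T.IsBranch Φ κ k σ ρ₀ r φ) (hκ : 0 ≤ κ) (hσ : σ = 1 ∨ σ = -1) (h0 : 0 ≤ ρ₀)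
    (hreg : IsRegular T Φ k E G) (hstart : T.pos ρ₀ 0 ∈ T.virtualLOS k)
    (hc : ∀ x ∈ T.virtualLOS k, c ≤ Φ k x) {t : ℝ} (ht : 0 ≤ t)
    (hns : ∀ τ, 0 ≤ τ → τ ≤ t → ¬ T.Stop Φ k (r τ) (φ τ)) : c ≤ T.F Φ k (r t) (φ t) := by
  have hcl : closure (T.virtualLOS k) ⊆ {x | c ≤ Φ k x} :=
    closure_minimal hc (isClosed_le continuous_const hreg.continuous)
  have hE : ∀ s, 0 ≤ s → s ≤ t → T.pos (r s) (φ s) ∈ E := fun s h1 h2 =>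
    hreg.mem_of_running _ _ (hb.r_nonneg hκ h0 h1 fun τ h3 h4 => hns τ h3 (h4.le.trans h2))
      (hb.abs_φ_lt hκ hσ h0 h1 fun τ h3 h4 => hns τ h3 (h4.trans h2)) (hns s h1 h2)
  -- The last time `s` in the closure of the virtual line-of-sight region: there the bound holds by
  -- continuity, and afterwards all velocities are contour velocities, along which `G` does not
  -- decrease.
  let A : Set ℝ := Icc 0 t ∩ (fun s => T.pos (r s) (φ s)) ⁻¹' closure (T.virtualLOS k)
  have hA : IsCompact A := by
    refine isCompact_Icc.of_isClosed_subset ?_ inter_subset_left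
    exact (hb.pos_continuousOn.mono fun s hs => hs.1).preimage_isClosed_of_isClosed isClosed_Icc
      isClosed_closure
  have hA0 : (0 : ℝ) ∈ A := by
    refine ⟨⟨le_rfl, ht⟩, subset_closure ?_⟩
    show T.pos (r 0) (φ 0) ∈ T.virtualLOS k
    rwa [hb.r_init, hb.φ_init]
  have hs : sSup A ∈ A := hA.sSup_mem ⟨0, hA0⟩
  set s := sSup A
  have hout : ∀ τ, s < τ → τ ≤ t → T.pos (r τ) (φ τ) ∉ closure (T.virtualLOS k) := by
    intro τ h1 h2 h3
    exact h1.not_ge (le_csSup hA.bddAbove ⟨⟨hs.1.1.trans h1.le, h2⟩, h3⟩)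
  refine (show c ≤ Φ k (T.pos (r s) (φ s)) from hcl hs.2).trans ?_
  refine hreg.le_of_le _ (hE s hs.1.1 hs.1.2) _ (hE t ht le_rfl) ?_
  have hH : ContDiff ℝ 1 (fun p : ℝ × ℝ => G (T.pos p.1 p.2)) := hreg.contDiff.comp T.contDiff_pos
  refine le_of_ae_hasDerivAt_nonneg (f := fun t => G (T.pos (r t) (φ t))) hs.1.2
    (absolutelyContinuousOnInterval_comp_prod hH hs.1.1 hs.1.2 hb.r_lipschitz hb.φ_lipschitz) ?_
  filter_upwards [hb.flow] with τ hτ h1 h2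
  have h0τ : 0 ≤ τ := hs.1.1.trans h1.le
  have hnsτ : ∀ τ', 0 ≤ τ' → τ' ≤ τ → ¬ T.Stop Φ k (r τ') (φ τ') :=
    fun τ' h3 h4 => hns τ' h3 (h4.trans h2.le)
  obtain ⟨w, -, hr, hφ, hw⟩ := hτ h0τ hnsτ
  refine ⟨_, hreg.contour κ σ hσ (r τ) (φ τ)
    (hb.r_nonneg hκ h0 h0τ fun τ' h3 h4 => hnsτ τ' h3 h4.le)
    (hb.abs_φ_lt hκ hσ h0 h0τ hnsτ) (hb.φ_nonneg hκ hσ h0 h0τ fun τ' h3 h4 => hnsτ τ' h3 h4.le)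
    (hnsτ τ h0τ le_rfl) w (hw (hout τ h1 h2.le)), ?_⟩
  have hd : HasFDerivAt (fun p : ℝ × ℝ => G (T.pos p.1 p.2))
      (fderiv ℝ (fun p : ℝ × ℝ => G (T.pos p.1 p.2)) (r τ, φ τ)) (r τ, φ τ) :=
    (hH.differentiable (by norm_num) _).hasFDerivAt
  exact hd.comp_hasDerivAt τ (hr.prodMk hφ)

/-- A branch on the side of a position that minimizes the segment cost over the virtual
line-of-sight region visits such a position. -/
lemma exists_visit (hb : T.IsBranch Φ κ k σ ρ₀ r φ) (hκ : 0 < κ) (hσ : σ = 1 ∨ σ = -1)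
    (hcrit : T.IsCritical Φ k ρ₀) (hreg : IsRegular T Φ k E G) {ρs ψ : ℝ} (hψ : 0 ≤ ψ)
    (hψ' : ψ < Real.pi / 2) (hρs : 0 < ρs) (hρs' : ρs ≤ T.L * Real.cos ψ)
    (hmem : T.pos ρs (σ * ψ) ∈ T.virtualLOS k)
    (hc : ∀ x ∈ T.virtualLOS k, T.F Φ k ρs (σ * ψ) ≤ Φ k x) :
    ∃ t, 0 ≤ t ∧ (∀ τ, 0 ≤ τ → τ < t → ¬ T.Stop Φ k (r τ) (φ τ)) ∧
      T.pos (r t) (φ t) ∈ T.virtualLOS k ∧ T.F Φ k (r t) (φ t) ≤ T.F Φ k ρs (σ * ψ) := by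
  obtain ⟨h0, hstart, hmin⟩ := hcrit
  have hσσ : ∀ x : ℝ, σ * (σ * x) = x := by
    intro x; rcases hσ with rfl | rfl <;> ring
  have hcosσ : ∀ x : ℝ, Real.cos (σ * x) = Real.cos x := by
    intro x; rcases hσ with rfl | rfl <;> simp
  have hL := T.L_pos
  -- If `ρs ≤ ρ₀`, the starting point is already good enough: the axis point at radius `ρs` competes
  -- with `ρ₀`, and turning it by `ψ` does not lower the cost.
  by_cases hlt : ρ₀ < ρs
  swap
  · push Not at hlt
    refine ⟨0, le_rfl, fun τ h1 h2 => absurd h2 h1.not_gt, ?_⟩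
    rw [hb.r_init, hb.φ_init]
    refine ⟨hstart, (hmin ρs hρs.le (virtualLOS_of_le T hstart hρs.le hlt)).trans ?_⟩
    simpa using hreg.angular_le σ hσ ρs 0 ψ hρs.le le_rfl hψ hψ'
  obtain ⟨tS, htS0, htS⟩ := hb.finite_duration hκ hσ h0
  set S : Set ℝ := {t | 0 ≤ t ∧ T.Stop Φ k (r t) (φ t)} with hS
  have hSbdd : BddBelow S := ⟨0, fun t ht => ht.1⟩
  have hSne : S.Nonempty := ⟨tS, htS0, htS⟩
  set D := sInf S with hD
  have hD0 : 0 ≤ D := le_csInf hSne fun t ht => ht.1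
  have hns : ∀ τ, 0 ≤ τ → τ < D → ¬ T.Stop Φ k (r τ) (φ τ) := fun τ h1 h2 h3 =>
    h2.not_ge (csInf_le hSbdd ⟨h1, h3⟩)
  have hrc : ContinuousOn r (Icc 0 D) := hb.r_continuousOn.mono fun s hs => hs.1
  have hφc : ContinuousOn (fun t => σ * φ t) (Icc 0 D) :=
    (continuousOn_const.mul hb.φ_continuousOn).mono fun s hs => hs.1
  -- every position of the trajectory, up to the end, has at least the optimal cost
  have hcost : ∀ t, 0 ≤ t → t ≤ D → T.F Φ k ρs (σ * ψ) ≤ T.F Φ k (r t) (φ t) := by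
    intro t ht htD
    rcases htD.lt_or_eq with htD | rfl
    · exact hb.le_cost hκ.le hσ h0 hreg hstart hc ht fun τ h1 h2 => hns τ h1 (h2.trans_lt htD)
    · rcases hD0.eq_or_lt with h | h
      · rw [← h, hb.r_init, hb.φ_init]
        exact hc _ hstart
      · have hcont : ContinuousWithinAt (fun t => T.F Φ k (r t) (φ t)) (Iio D) D := by
          have := (hreg.continuous.comp_continuousOn hb.pos_continuousOn).continuousAt
            (Ici_mem_nhds h)
          exact this.continuousWithinAt
        refine ge_of_tendsto hcont ?_
        filter_upwards [Ioo_mem_nhdsLT h] with t ht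
        exact hb.le_cost hκ.le hσ h0 hreg hstart hc ht.1.le
          fun τ h1 h2 => hns τ h1 (h2.trans_lt ht.2)
  -- the trajectory belongs to `E`, up to the end
  have hE : ∀ t, 0 ≤ t → t ≤ D → 0 < D → T.pos (r t) (φ t) ∈ E := by
    have hE' : ∀ t, 0 ≤ t → t < D → T.pos (r t) (φ t) ∈ E := fun t h1 h2 =>
      hreg.mem_of_running _ _ (hb.r_nonneg hκ.le h0 h1 fun τ h3 h4 => hns τ h3 (h4.trans h2))
        (hb.abs_φ_lt hκ.le hσ h0 h1 fun τ h3 h4 => hns τ h3 (h4.trans_lt h2)) (hns t h1 h2)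
    intro t ht htD h
    rcases htD.lt_or_eq with htD | rfl
    · exact hE' t ht htD
    · have hcont : ContinuousWithinAt (fun t => T.pos (r t) (φ t)) (Iio D) D :=
        (hb.pos_continuousOn.continuousAt (Ici_mem_nhds h)).continuousWithinAt
      refine hreg.isClosed.mem_of_tendsto hcont ?_
      filter_upwards [Ioo_mem_nhdsLT h] with t ht
      exact hE' t ht.1.le ht.2
  -- at the distance `ρs`, the trajectory cannot be at a smaller angle than `ψ`
  have hangle : ∀ t, 0 ≤ t → t ≤ D → 0 < D → r t = ρs → ψ ≤ σ * φ t := by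
    intro t ht htD h hrt
    by_contra! hcon
    have h1 := hb.φ_nonneg hκ.le hσ h0 ht fun τ h1 h2 => hns τ h1 (h2.trans_le htD)
    have h2 := hE t ht htD h
    have h3 := hcost t ht htD
    rw [hrt] at h2 h3
    have := hreg.angular_lt σ hσ ρs (σ * φ t) ψ hρs h1 hcon hψ' (by rwa [hσσ])
    rw [hσσ] at this
    linarith
  have hpass : ∀ t, 0 ≤ t → t ≤ D → ρs ≤ r t → ∃ s, 0 ≤ s ∧ s ≤ t ∧ r s = ρs ∧ ψ ≤ σ * φ s := by
    intro t ht htD hrt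
    obtain ⟨s, hs, hs'⟩ := intermediate_value_Icc ht
      (hrc.mono (Icc_subset_Icc_right htD)) (show ρs ∈ Icc (r 0) (r t) by
        rw [hb.r_init]; exact ⟨hlt.le, hrt⟩)
    refine ⟨s, hs.1, hs.2, hs', hangle s hs.1 (hs.2.trans htD) ?_ hs'⟩
    rcases hD0.eq_or_lt with h | h
    · have : s = 0 := le_antisymm (hs.2.trans (htD.trans h.ge)) hs.1
      rw [this, hb.r_init] at hs'
      exact absurd hs' hlt.ne
    · exact h
  -- at the end, the cost increases with the distance from the user
  have hend : σ * φ D ≤ ψ → r D < ρs → False := by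
    intro h1 h2
    have h3 := hb.φ_nonneg hκ.le hσ h0 hD0 hns
    have h4 : |φ D| = σ * φ D := abs_eq_of_sign hσ h3
    have h5 : Real.cos ψ ≤ Real.cos (φ D) := by
      rw [← hcosσ (φ D)]
      exact Real.cos_le_cos_of_nonneg_of_le_pi h3 (by linarith [Real.pi_pos]) h1
    have h6 : r D < T.L * Real.cos (φ D) :=
      h2.trans_le (hρs'.trans (mul_le_mul_of_nonneg_left h5 hL.le))
    have hcr : Tendsto r (𝓝[≥] D) (𝓝 (r D)) :=
      (hb.r_continuousOn D hD0).mono_left (nhdsWithin_mono _ (Ici_subset_Ici.2 hD0))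
    have hcφ : Tendsto φ (𝓝[≥] D) (𝓝 (φ D)) :=
      (hb.φ_continuousOn D hD0).mono_left (nhdsWithin_mono _ (Ici_subset_Ici.2 hD0))
    -- Stopping times accumulate at `D` from the right or include `D`. By continuity `r < L cos φ`
    -- persists near `D`, so it is the derivative criterion that holds at these times.
    have hfreq : ∃ᶠ t in 𝓝[≥] D, T.Stop Φ k (r t) (φ t) := by
      rw [Filter.Frequently]
      intro hev
      obtain ⟨u, hu, hu'⟩ := mem_nhdsGE_iff_exists_Ico_subset.1 hev
      obtain ⟨t, ht, htu⟩ := exists_lt_of_csInf_lt hSne hu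
      exact hu' ⟨csInf_le hSbdd ht, htu⟩ ht.2
    have hev : ∀ᶠ t in 𝓝[≥] D, r t < T.L * Real.cos (φ t) :=
      hcr.eventually_lt (((Real.continuous_cos.tendsto _).comp hcφ).const_mul T.L) h6
    have hfreq' : ∃ᶠ p in 𝓝 (r D, φ D), 0 ≤ T.Fρ Φ k p.1 p.2 := by
      have : Tendsto (fun t => (r t, φ t)) (𝓝[≥] D) (𝓝 (r D, φ D)) := hcr.prodMk_nhds hcφ
      refine this.frequently ((hfreq.and_eventually hev).mono ?_)
      rintro t ⟨h | h, h'⟩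
      · exact absurd h h'.not_ge
      · exact h
    have h7 := hreg.strictMonoOn (r D) (φ D) (hb.r_nonneg hκ.le h0 hD0 hns)
      (by rw [h4]; linarith) h6 hfreq' (left_mem_Icc.2 h6.le)
      ⟨h2.le, hρs'.trans (mul_le_mul_of_nonneg_left h5 hL.le)⟩ h2
    have h8 := hreg.angular_le σ hσ ρs (σ * φ D) ψ hρs.le h3 h1 hψ'
    rw [hσσ] at h8
    have h9 := hcost D hD0 le_rfl
    simp only at h7
    linarith
  have hvisit : ∀ t, 0 ≤ t → t ≤ D → r t = ρs → σ * φ t = ψ →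
      ∃ t, 0 ≤ t ∧ (∀ τ, 0 ≤ τ → τ < t → ¬ T.Stop Φ k (r τ) (φ τ)) ∧
      T.pos (r t) (φ t) ∈ T.virtualLOS k ∧ T.F Φ k (r t) (φ t) ≤ T.F Φ k ρs (σ * ψ) := by
    intro t ht htD hrt hφt
    have : φ t = σ * ψ := by rw [← hφt, hσσ]
    refine ⟨t, ht, fun τ h1 h2 => hns τ h1 (h2.trans_le htD), ?_⟩
    rw [hrt, this]
    exact ⟨hmem, le_rfl⟩
  by_cases hψD : ψ ≤ σ * φ D
  swap
  · push Not at hψD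
    exfalso
    by_cases h : r D < ρs
    · exact hend hψD.le h
    · push Not at h
      obtain ⟨s, h1, h2, h3, h4⟩ := hpass D hD0 le_rfl h
      linarith [hb.φ_le hκ.le hσ h0 h1 h2 hns]
  -- A time at which the branch has exactly the angle of the target; it remains to compare the
  -- radius with `ρs`.
  obtain ⟨t, ht, htψ⟩ := intermediate_value_Icc hD0 hφc (show ψ ∈ Icc (σ * φ 0) (σ * φ D) by
    rw [hb.φ_init, mul_zero]; exact ⟨hψ, hψD⟩)
  simp only at htψ
  by_cases hrt : ρs ≤ r t
  · obtain ⟨s, h1, h2, h3, h4⟩ := hpass t ht.1 ht.2 hrt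
    refine hvisit s h1 (h2.trans ht.2) h3 (le_antisymm ?_ h4)
    have := hb.φ_le hκ.le hσ h0 h1 h2 fun τ h1 h2 => hns τ h1 (h2.trans_le ht.2)
    linarith
  push Not at hrt
  have hφt : φ t = σ * ψ := by rw [← htψ, hσσ]
  have hrt0 := hb.r_nonneg hκ.le h0 ht.1 fun τ h1 h2 => hns τ h1 (h2.trans_le ht.2)
  -- Both ends of the segment lie on the ray through the target, no farther out than the target,
  -- hence in the virtual line-of-sight region, so the motion is radial.
  have hrad : ∀ s, 0 ≤ s → t + s ≤ D → r t + κ * s ≤ ρs →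
      r (t + s) = r t + κ * s ∧ φ (t + s) = φ t := by
    intro s hs hsD hsρ
    refine hb.radial t s ht.1 hs (fun τ h1 h2 => hns τ h1 (h2.trans_le hsD)) ?_ ?_
    · rw [hφt]; exact virtualLOS_of_le T hmem hrt0 hrt.le
    · rw [hφt]; exact virtualLOS_of_le T hmem (by positivity) hsρ
  have hs0 : 0 ≤ (ρs - r t) / κ := div_nonneg (by linarith) hκ.le
  have hsκ : κ * ((ρs - r t) / κ) = ρs - r t := by field_simp
  by_cases hsD : t + (ρs - r t) / κ ≤ D
  · obtain ⟨h1, h2⟩ := hrad _ hs0 hsD (by rw [hsκ]; linarith)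
    refine hvisit _ (add_nonneg ht.1 hs0) hsD ?_ ?_
    · rw [h1, hsκ]; ring
    · rw [h2, htψ]
  -- Stopping before the target is reached would mean stopping at angle `ψ` and radius below `ρs`,
  -- which `hend` excludes.
  · push Not at hsD
    exfalso
    have h3 : κ * (D - t) < ρs - r t := by
      rw [← hsκ]
      exact mul_lt_mul_of_pos_left (by linarith) hκ
    obtain ⟨h1, h2⟩ := hrad (D - t) (by linarith [ht.2]) (by linarith) (by linarith)
    rw [add_sub_cancel] at h1 h2
    exact hend (by rw [h2, htψ]) (by linarith)

end IsBranch

end Terrain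

/-! ### From branches to the whole search -/

namespace Terrain

lemma branchSide_eq (i : ℕ) : branchSide i = 1 ∨ branchSide i = -1 := by
  unfold branchSide; split_ifs <;> simp

lemma branchIndex_mem {K i : ℕ} (hi : i < 2 * (K - 1)) :
    1 ≤ branchIndex i ∧ branchIndex i < K := by
  unfold branchIndex; omega

lemma exists_branch {K k : ℕ} (hk : 1 ≤ k) (hkK : k < K) {σ : ℝ} (hσ : σ = 1 ∨ σ = -1) :
    ∃ i < 2 * (K - 1), branchIndex i = k ∧ branchSide i = σ := by
  rcases hσ with rfl | rfl
  · refine ⟨2 * (k - 1), by omega, by unfold branchIndex; omega, ?_⟩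
    unfold branchSide
    rw [if_pos (by omega)]
  · refine ⟨2 * (k - 1) + 1, by omega, by unfold branchIndex; omega, ?_⟩
    unfold branchSide
    rw [if_neg (by omega)]

end Terrain

namespace Run

variable {R : Run} {T : Terrain} {Φ : ℕ → Plane → ℝ}

lemma le_duration {i : ℕ} {τ : ℝ}
    (h : ∀ s, 0 ≤ s → s < τ → ¬ T.Stop Φ (Terrain.branchIndex i) (R.r i s) (R.φ i s)) :
    ENNReal.ofReal τ ≤ R.duration T Φ i := by
  refine le_sInf ?_
  rintro _ ⟨t, ⟨ht, hst⟩, rfl⟩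
  refine ENNReal.ofReal_le_ofReal ?_
  by_contra! hlt
  exact h t ht hlt hst

lemma start_add_duration_le {i n : ℕ} (hi : i < n) :
    R.start T Φ i + R.duration T Φ i ≤ R.start T Φ n := by
  unfold start
  rw [← Finset.sum_range_succ]
  exact Finset.sum_le_sum_of_subset (Finset.range_mono hi)

lemma IsValid.start_lt_top {κ : ℝ} (hκ : 0 < κ) (hR : R.IsValid T Φ κ) :
    R.start T Φ (2 * (T.K - 1)) < ⊤ := by
  refine ENNReal.sum_lt_top.2 fun i hi => ?_
  rw [Finset.mem_range] at hi
  obtain ⟨h1, h2⟩ := Terrain.branchIndex_mem hi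
  obtain ⟨t, ht, hst⟩ := (hR.branch i hi).finite_duration hκ (Terrain.branchSide_eq i)
    (hR.critical _ h1 h2).1
  exact (sInf_le ⟨t, ⟨ht, hst⟩, rfl⟩ : R.duration T Φ i ≤ ENNReal.ofReal t).trans_lt
    ENNReal.ofReal_lt_top

/-- The positions visited by the whole search. -/
def allVisited (R : Run) (T : Terrain) (Φ : ℕ → Plane → ℝ) : Set Plane :=
  {x | (∃ i < 2 * (T.K - 1), ∃ τ : ℝ, 0 ≤ τ ∧ ENNReal.ofReal τ ≤ R.duration T Φ i ∧
        x = T.pos (R.r i τ) (R.φ i τ)) ∨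
      (T.IsLastCritical Φ (R.ρ₀ T.K) ∧ x = T.pos (R.ρ₀ T.K) 0)}

lemma allVisited_subset {t : ℝ} (ht : R.start T Φ (2 * (T.K - 1)) ≤ ENNReal.ofReal t) :
    R.allVisited T Φ ⊆ R.visited T Φ t := by
  rintro x (⟨i, hi, τ, h0, hτ, rfl⟩ | ⟨h, rfl⟩)
  · exact Or.inl ⟨i, hi, τ, h0, hτ,
      ((add_le_add_right hτ _).trans (start_add_duration_le hi)).trans ht, rfl⟩
  · exact Or.inr ⟨ht, h, rfl⟩

/-- After the total search time all positions have been visited, so one visited global minimizer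
settles every claim. -/
lemma reachesOptimum_of_visit {J : Plane → ℝ} (hfin : R.start T Φ (2 * (T.K - 1)) < ⊤)
    {x : Plane} (hx : x ∈ R.allVisited T Φ) (hmin : ∀ y, J x ≤ J y) :
    R.ReachesOptimum T Φ J := by
  refine ⟨hfin, (R.start T Φ (2 * (T.K - 1))).toReal, ENNReal.toReal_nonneg, fun t ht => ?_⟩
  have hv := allVisited_subset ((ENNReal.le_ofReal_iff_toReal_le hfin.ne
    (ENNReal.toReal_nonneg.trans ht)).2 ht) hx
  refine ⟨⟨x, hv, fun y _ => hmin y⟩, fun z hz y => (hz.2 x hv).trans (hmin y), ?_⟩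
  have : R.Fmin T Φ J t = J x :=
    IsLeast.csInf_eq ⟨mem_image_of_mem J hv, by rintro _ ⟨y, -, rfl⟩; exact hmin y⟩
  rw [this]
  exact ⟨mem_range_self x, by rintro _ ⟨y, rfl⟩; exact hmin y⟩

/-- The search visits a global minimizer if there is one on the axis. -/
lemma IsValid.exists_visit_of_axis {κ : ℝ} (hR : R.IsValid T Φ κ)
    (hord : ∀ j k, 1 ≤ j → j ≤ k → k ≤ T.K → ∀ x, Φ j x ≤ Φ k x) {ρ : ℝ} (hρ : 0 ≤ ρ)
    (hmin : ∀ y, T.total Φ (T.pos ρ 0) ≤ T.total Φ y) :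
    ∃ x ∈ R.allVisited T Φ, T.total Φ x ≤ T.total Φ (T.pos ρ 0) := by
  obtain ⟨hk, hkK⟩ := T.seg_mem (T.pos ρ 0)
  rcases hkK.lt_or_eq with hlt | heq
  · obtain ⟨i, hi, hik, -⟩ := Terrain.exists_branch hk hlt (Or.inl rfl)
    obtain ⟨h0, hmem, hc⟩ := hR.critical _ hk hlt
    refine ⟨T.pos (R.r i 0) (R.φ i 0), Or.inl ⟨i, hi, 0, le_rfl, by simp, rfl⟩, ?_⟩
    rw [(hR.branch i hi).r_init, (hR.branch i hi).φ_init, hik, T.total_eq, T.total_eq]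
    exact (hord _ _ (T.seg_mem _).1 hmem hkK _).trans (hc ρ hρ (le_refl (T.seg (T.pos ρ 0))))
  · have hlast : T.IsLastCritical Φ ρ := by
      refine ⟨hρ, heq, fun ρ' hρ' h => ?_⟩
      have := hmin (T.pos ρ' 0)
      rw [T.total_eq, T.total_eq, h, heq] at this
      exact this
    have h := hR.lastCritical ⟨ρ, hlast⟩
    refine ⟨_, Or.inr ⟨h, rfl⟩, ?_⟩
    rw [T.total_eq, T.total_eq, h.2.1, heq]
    exact h.2.2 ρ hρ heq

/-- Below the last segment, the branch on the side of the minimizer finds an optimum; in the last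
segment, turning the minimizer onto the axis does not raise the cost. -/
lemma IsValid.exists_visit {κ : ℝ} (hκ : 0 < κ) (hR : R.IsValid T Φ κ)
    (hord : ∀ j k, 1 ≤ j → j ≤ k → k ≤ T.K → ∀ x, Φ j x ≤ Φ k x)
    (hreg : ∀ k, 1 ≤ k → k ≤ T.K → ∃ E G, IsRegular T Φ k E G) {ρ θ : ℝ} (hρ : 0 ≤ ρ)
    (hρL : ρ ≤ T.L * Real.cos θ) (hθ : |θ| ≤ Real.pi / 2)
    (hmin : ∀ y, T.total Φ (T.pos ρ θ) ≤ T.total Φ y) :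
    ∃ x ∈ R.allVisited T Φ, T.total Φ x ≤ T.total Φ (T.pos ρ θ) := by
  rcases hρ.eq_or_lt with rfl | hρ0
  · rw [T.pos_zero, ← T.pos_zero 0] at hmin ⊢
    exact hR.exists_visit_of_axis hord le_rfl hmin
  obtain ⟨σ, hσ, hθσ⟩ : ∃ σ : ℝ, (σ = 1 ∨ σ = -1) ∧ θ = σ * |θ| := by
    rcases abs_cases θ with h | h
    · exact ⟨1, Or.inl rfl, by rw [one_mul, h.1]⟩
    · exact ⟨-1, Or.inr rfl, by rw [h.1]; ring⟩
  -- At a right angle the bound `ρ ≤ L cos θ` would force `ρ = 0`.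
  have hθ' : |θ| < Real.pi / 2 := by
    refine hθ.lt_of_ne fun h => ?_
    rw [← Real.cos_abs, h, Real.cos_pi_div_two, mul_zero] at hρL
    exact hρ0.not_ge hρL
  obtain ⟨hk, hkK⟩ := T.seg_mem (T.pos ρ θ)
  obtain ⟨E, G, hEG⟩ := hreg _ hk hkK
  rcases hkK.lt_or_eq with hlt | heq
  · obtain ⟨i, hi, hik, hiσ⟩ := Terrain.exists_branch hk hlt hσ
    have hb := hR.branch i hi
    have hcrit := hR.critical _ hk hlt
    rw [hik, hiσ] at hb
    obtain ⟨t, ht, hns, hmem, hle⟩ := hb.exists_visit hκ hσ hcrit hEG (abs_nonneg θ) hθ' hρ0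
      (by rwa [Real.cos_abs]) (by rw [← hθσ]; exact le_refl (T.seg (T.pos ρ θ))) (by
        intro x hx
        -- On the virtual line-of-sight region `Φ k` dominates the true cost, so the global minimum
        -- bounds it from below.
        rw [← hθσ, Terrain.F, ← T.total_eq Φ]
        refine (hmin x).trans ?_
        rw [T.total_eq]
        exact hord _ _ (T.seg_mem _).1 hx hkK x)
    refine ⟨_, Or.inl ⟨i, hi, t, ht, le_duration (by rwa [hik]), rfl⟩, ?_⟩
    rw [T.total_eq, T.total_eq]
    rw [← hθσ] at hle
    exact (hord _ _ (T.seg_mem _).1 hmem hkK _).trans hle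
  · have hle : T.total Φ (T.pos ρ 0) ≤ T.total Φ (T.pos ρ θ) := by
      rw [T.total_eq, T.total_eq]
      refine (hord _ _ (T.seg_mem _).1 ((T.seg_mem _).2.trans heq.ge) hkK _).trans ?_
      have := hEG.angular_le σ hσ ρ 0 |θ| hρ le_rfl (abs_nonneg θ) hθ'
      rwa [← hθσ, mul_zero] at this
    obtain ⟨x, hx, hxle⟩ := hR.exists_visit_of_axis hord hρ fun y => hle.trans (hmin y)
    exact ⟨x, hx, hxle.trans hle⟩

/-- Optimality of the search for regular segment costs. -/
theorem IsValid.reachesOptimum {κ : ℝ} (hκ : 0 < κ) (hR : R.IsValid T Φ κ)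
    (hord : ∀ j k, 1 ≤ j → j ≤ k → k ≤ T.K → ∀ x, Φ j x ≤ Φ k x)
    (hreg : ∀ k, 1 ≤ k → k ≤ T.K → ∃ E G, IsRegular T Φ k E G)
    (hopt : ∃ ρ θ : ℝ, 0 ≤ ρ ∧ ρ ≤ T.L * Real.cos θ ∧ |θ| ≤ Real.pi / 2 ∧
      ∀ y, T.total Φ (T.pos ρ θ) ≤ T.total Φ y) :
    R.ReachesOptimum T Φ (T.total Φ) := by
  obtain ⟨ρ, θ, h1, h2, h3, h4⟩ := hopt
  obtain ⟨x, hx, hle⟩ := hR.exists_visit hκ hord hreg h1 h2 h3 h4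
  exact reachesOptimum_of_visit (hR.start_lt_top hκ) hx fun y => hle.trans (h4 y)

end Run

/-! ### Continuously differentiable segment costs -/

section SmoothCost

variable {T : Terrain} {Φ : ℕ → Plane → ℝ} {k : ℕ}

lemma contDiff_polar (h : ContDiff ℝ 1 (Φ k)) :
    ContDiff ℝ 1 (fun p : ℝ × ℝ => Φ k (T.pos p.1 p.2)) :=
  h.comp T.contDiff_pos

lemma hasDerivAt_polar_radial (h : ContDiff ℝ 1 (Φ k)) (ρ θ : ℝ) :
    HasDerivAt (fun r => T.F Φ k r θ)
      (fderiv ℝ (fun p : ℝ × ℝ => Φ k (T.pos p.1 p.2)) (ρ, θ) (1, 0)) ρ := by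
  have hd := ((contDiff_polar (T := T) h).differentiable (by norm_num) (ρ, θ)).hasFDerivAt
  exact hd.comp_hasDerivAt ρ ((hasDerivAt_id ρ).prodMk (hasDerivAt_const ρ θ))

lemma hasDerivAt_polar_angular (h : ContDiff ℝ 1 (Φ k)) (ρ θ : ℝ) :
    HasDerivAt (fun t => T.F Φ k ρ t)
      (fderiv ℝ (fun p : ℝ × ℝ => Φ k (T.pos p.1 p.2)) (ρ, θ) (0, 1)) θ := by
  have hd := ((contDiff_polar (T := T) h).differentiable (by norm_num) (ρ, θ)).hasFDerivAt
  exact hd.comp_hasDerivAt θ ((hasDerivAt_const θ ρ).prodMk (hasDerivAt_id θ))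

lemma Fρ_eq (h : ContDiff ℝ 1 (Φ k)) (ρ θ : ℝ) :
    T.Fρ Φ k ρ θ = fderiv ℝ (fun p : ℝ × ℝ => Φ k (T.pos p.1 p.2)) (ρ, θ) (1, 0) :=
  (hasDerivAt_polar_radial h ρ θ).hasDerivWithinAt.derivWithin (uniqueDiffWithinAt_Iic ρ)

lemma Fθ_eq (h : ContDiff ℝ 1 (Φ k)) (ρ θ : ℝ) :
    T.Fθ Φ k ρ θ = fderiv ℝ (fun p : ℝ × ℝ => Φ k (T.pos p.1 p.2)) (ρ, θ) (0, 1) :=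
  (hasDerivAt_polar_angular h ρ θ).hasDerivWithinAt.derivWithin (uniqueDiffWithinAt_Iic θ)

lemma hasDerivAt_Fρ (h : ContDiff ℝ 1 (Φ k)) (ρ θ : ℝ) :
    HasDerivAt (fun r => T.F Φ k r θ) (T.Fρ Φ k ρ θ) ρ := by
  rw [Fρ_eq h]; exact hasDerivAt_polar_radial h ρ θ

lemma hasDerivAt_Fθ (h : ContDiff ℝ 1 (Φ k)) (ρ θ : ℝ) :
    HasDerivAt (fun t => T.F Φ k ρ t) (T.Fθ Φ k ρ θ) θ := by
  rw [Fθ_eq h]; exact hasDerivAt_polar_angular h ρ θ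

lemma continuous_Fρ (h : ContDiff ℝ 1 (Φ k)) :
    Continuous (fun p : ℝ × ℝ => T.Fρ Φ k p.1 p.2) := by
  simp only [Fρ_eq h, Prod.mk.eta]
  exact ((contDiff_polar h).continuous_fderiv (by norm_num)).clm_apply continuous_const

/-- A continuously differentiable segment cost that increases with the deviation angle and, beyond
the points where the radial stopping criterion is met, with the distance, is regular. -/
lemma isRegular_of_contDiff (h : ContDiff ℝ 1 (Φ k))
    (hrad : ∀ ρ θ, 0 ≤ ρ → |θ| < Real.pi / 2 → ρ < T.L * Real.cos θ → 0 ≤ T.Fρ Φ k ρ θ →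
      StrictMonoOn (fun r => T.F Φ k r θ) (Icc ρ (T.L * Real.cos θ)))
    (hang : ∀ σ : ℝ, (σ = 1 ∨ σ = -1) → ∀ ρ ψ ψ', 0 < ρ → 0 ≤ ψ → ψ < ψ' →
      ψ' < Real.pi / 2 → T.F Φ k ρ (σ * ψ) < T.F Φ k ρ (σ * ψ')) :
    IsRegular T Φ k univ (Φ k) where
  continuous := h.continuous
  isClosed := isClosed_univ
  mem_of_running _ _ _ _ _ := mem_univ _
  strictMonoOn ρ θ h0 h1 h2 h3 := by
    refine hrad ρ θ h0 h1 h2 ?_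
    -- Continuity of `Fρ` turns nonnegativity arbitrarily close to the point into nonnegativity at
    -- the point.
    by_contra! hneg
    have hc : ContinuousAt (fun p : ℝ × ℝ => T.Fρ Φ k p.1 p.2) (ρ, θ) :=
      (continuous_Fρ h).continuousAt
    have hev : ∀ᶠ p : ℝ × ℝ in 𝓝 (ρ, θ), T.Fρ Φ k p.1 p.2 < 0 := hc.eventually_lt_const hneg
    exact h3 (hev.mono fun p hp => not_le.2 hp)
  angular_le σ hσ ρ ψ ψ' h0 h1 h2 h3 := by
    rcases h0.eq_or_lt with rfl | h0
    · simp [Terrain.F]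
    rcases h2.eq_or_lt with rfl | h2
    · exact le_rfl
    · exact (hang σ hσ ρ ψ ψ' h0 h1 h2 h3).le
  angular_lt σ hσ ρ ψ ψ' h0 h1 h2 h3 _ := hang σ hσ ρ ψ ψ' h0 h1 h2 h3
  contDiff := h
  le_of_le _ _ _ _ hxy := hxy
  contour κ σ _ ρ θ _ _ _ _ w hw := by
    have h1 := hw.2.2.1
    rw [Fρ_eq h, Fθ_eq h] at h1
    have h2 : w = w.1 • ((1 : ℝ), (0 : ℝ)) + w.2 • ((0 : ℝ), (1 : ℝ)) := by ext <;> simp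
    rw [h2, map_add, map_smul, map_smul, smul_eq_mul, smul_eq_mul]
    linarith

/-- The radial derivative has no zero away from the minimizer `ρs`, and minimality at `ρs` makes it
negative before and positive after. A nonnegative derivative at `ρ` therefore places `ρ` at or
beyond `ρs`. -/
lemma UniqueRadialMin.strictMonoOn (h : ContDiff ℝ 1 (Φ k)) (hu : UniqueRadialMin T Φ k)
    {ρ θ : ℝ} (h0 : 0 ≤ ρ) (hθ : |θ| < Real.pi / 2) (hρ : 0 ≤ T.Fρ Φ k ρ θ) :
    StrictMonoOn (fun r => T.F Φ k r θ) (Ici ρ) := by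
  obtain ⟨ρs, hs0, hs⟩ := hu θ hθ
  set f : ℝ → ℝ := fun r => T.F Φ k r θ with hf
  have hd : ∀ r, HasDerivAt f (T.Fρ Φ k r θ) r := fun r => hasDerivAt_Fρ h r θ
  have hdc : Continuous (fun r => T.Fρ Φ k r θ) :=
    Continuous.comp (g := fun p : ℝ × ℝ => T.Fρ Φ k p.1 p.2) (f := fun r : ℝ => (r, θ))
      (continuous_Fρ h) (by fun_prop)
  have hfc : Continuous f := continuous_iff_continuousAt.2 fun r => (hd r).continuousAt
  have hmin : IsLocalMinOn f (Ici 0) ρs := (hs ρs hs0).1.2 rfl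
  -- the derivative has a constant sign on either side of the minimizer
  have hsign : ∀ a b : ℝ, a ≤ b → (∀ r ∈ Icc a b, T.Fρ Φ k r θ ≠ 0) →
      (0 < T.Fρ Φ k a θ ↔ 0 < T.Fρ Φ k b θ) := by
    intro a b hab hne
    by_contra hcon
    have : (0 : ℝ) ∈ uIcc (T.Fρ Φ k a θ) (T.Fρ Φ k b θ) := by
      rw [mem_uIcc]
      by_cases ha : 0 < T.Fρ Φ k a θ
      · right
        exact ⟨not_lt.1 fun hb => hcon ⟨fun _ => hb, fun _ => ha⟩, ha.le⟩
      · left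
        exact ⟨not_lt.1 ha, (not_le.1 fun hb => hcon ⟨fun h => absurd h ha,
          fun h => absurd h hb.not_gt⟩).le⟩
    obtain ⟨r, hr, hr0⟩ := intermediate_value_uIcc hdc.continuousOn this
    rw [uIcc_of_le hab] at hr
    exact hne r hr hr0
  have hright : ∀ r, ρs < r → 0 < T.Fρ Φ k r θ := by
    intro b hb
    by_contra hcon
    -- A derivative that is not positive at `b` would be negative on all of `(ρs, b]`, giving
    -- smaller values arbitrarily close to the local minimizer.
    have hneg : ∀ r ∈ Ioc ρs b, T.Fρ Φ k r θ < 0 := by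
      intro r hr
      have hne : ∀ r' ∈ Icc r b, T.Fρ Φ k r' θ ≠ 0 := fun r' h' =>
        (hs r' (hs0.trans (hr.1.le.trans h'.1))).2 (hr.1.trans_le h'.1).ne'
      refine lt_of_le_of_ne (not_lt.1 fun hp => hcon ((hsign r b hr.2 hne).1 hp))
        (hne r ⟨le_rfl, hr.2⟩)
    have hanti : StrictAntiOn f (Icc ρs b) :=
      strictAntiOn_of_deriv_neg (convex_Icc _ _) hfc.continuousOn fun r hr => by
        rw [interior_Icc] at hr
        rw [(hd r).deriv]
        exact hneg r ⟨hr.1, hr.2.le⟩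
    have hev : ∀ᶠ r in 𝓝[>] ρs, f ρs ≤ f r :=
      hmin.filter_mono (nhdsWithin_mono _ fun r hr => hs0.trans (le_of_lt hr))
    obtain ⟨r, hr1, hr2⟩ := (hev.and (Ioc_mem_nhdsGT hb)).exists
    exact (hanti (left_mem_Icc.2 hb.le) ⟨hr2.1.le, hr2.2⟩ hr2.1).not_ge hr1
  have hle : ρs ≤ ρ := by
    by_contra! hlt
    have hne : ∀ r, 0 ≤ r → r < ρs → T.Fρ Φ k r θ ≠ 0 := fun r h1 h2 => (hs r h1).2 h2.ne
    have hpos : ∀ r ∈ Ico ρ ρs, 0 < T.Fρ Φ k r θ := by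
      intro r hr
      refine (hsign ρ r hr.1 fun r' h' => hne r' (h0.trans h'.1) (h'.2.trans_lt hr.2)).1 ?_
      exact lt_of_le_of_ne hρ (hne ρ h0 hlt).symm
    have hmono : StrictMonoOn f (Icc ρ ρs) :=
      strictMonoOn_of_deriv_pos (convex_Icc _ _) hfc.continuousOn fun r hr => by
        rw [interior_Icc] at hr
        rw [(hd r).deriv]
        exact hpos r ⟨hr.1.le, hr.2⟩
    have hev : ∀ᶠ r in 𝓝[Ico ρ ρs] ρs, f ρs ≤ f r :=
      hmin.filter_mono (nhdsWithin_mono _ fun r hr => h0.trans hr.1)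
    have : (𝓝[Ico ρ ρs] ρs).NeBot := by
      rw [nhdsWithin_Ico_eq_nhdsLT hlt]; infer_instance
    obtain ⟨r, hr1, hr2⟩ := (hev.and self_mem_nhdsWithin).exists
    exact (hmono ⟨hr2.1, hr2.2.le⟩ (right_mem_Icc.2 hlt.le) hr2.2).not_ge hr1
  refine strictMonoOn_of_deriv_pos (convex_Ici _) hfc.continuousOn fun r hr => ?_
  rw [interior_Ici] at hr
  rw [(hd r).deriv]
  exact hright r (hle.trans_lt hr)

lemma AngularMono.lt (h : ContDiff ℝ 1 (Φ k)) (ha : AngularMono T Φ k) {σ : ℝ}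
    (hσ : σ = 1 ∨ σ = -1) {ρ ψ ψ' : ℝ} (hρ : 0 < ρ) (h0 : 0 ≤ ψ) (hψ : ψ < ψ')
    (hψ' : ψ' < Real.pi / 2) : T.F Φ k ρ (σ * ψ) < T.F Φ k ρ (σ * ψ') := by
  have hd : ∀ t, HasDerivAt (fun t => T.F Φ k ρ (σ * t)) (T.Fθ Φ k ρ (σ * t) * (σ * 1)) t :=
    fun t => (hasDerivAt_Fθ h ρ (σ * t)).comp t ((hasDerivAt_id t).const_mul σ)
  refine strictMonoOn_of_deriv_pos (convex_Icc ψ ψ')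
    (fun t _ => (hd t).continuousAt.continuousWithinAt) (fun t ht => ?_)
    (left_mem_Icc.2 hψ.le) (right_mem_Icc.2 hψ.le) hψ
  rw [interior_Icc] at ht
  rw [(hd t).deriv]
  have ht0 : 0 < t := h0.trans_lt ht.1
  have htπ : t < Real.pi / 2 := ht.2.trans hψ'
  rcases hσ with rfl | rfl
  · have := (ha ρ (1 * t) hρ (by rw [one_mul, abs_of_pos ht0]; exact htπ)).1 (by linarith)
    simpa using this
  · have := (ha ρ (-1 * t) hρ (by rw [neg_one_mul, abs_neg, abs_of_pos ht0]; exact htπ)).2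
      (by linarith)
    linarith

lemma isRegular_of_uniqueRadialMin (h : ContDiff ℝ 1 (Φ k)) (hu : UniqueRadialMin T Φ k)
    (ha : AngularMono T Φ k) : IsRegular T Φ k univ (Φ k) :=
  isRegular_of_contDiff h
    (fun _ _ h0 h1 _ h3 => (hu.strictMonoOn h h0 h1 h3).mono Icc_subset_Ici_self)
    (fun _ hσ _ _ _ h0 h1 h2 h3 => ha.lt h hσ h0 h1 h2 h3)

end SmoothCost

/-! ### Channel gains -/

/-- The channel gain as a function of the horizontal distance `m`, where `c` is the square of the
vertical distance. -/
def gain (β α c m : ℝ) : ℝ := β * Real.sqrt (m ^ 2 + c) ^ (-α)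

section Gain

variable {β α c : ℝ}

lemma gain_pos (hβ : 0 < β) (hc : 0 < c) (m : ℝ) : 0 < gain β α c m := by
  unfold gain; positivity

lemma gain_lt (hβ : 0 < β) (hα : 0 < α) (hc : 0 < c) {c' m m' : ℝ} (h : m ^ 2 + c < m' ^ 2 + c') :
    gain β α c' m' < gain β α c m := by
  refine mul_lt_mul_of_pos_left (Real.rpow_lt_rpow_of_neg (by positivity) ?_ (by linarith)) hβ
  exact Real.sqrt_lt_sqrt (by positivity) h

lemma gain_le (hβ : 0 < β) (hα : 0 < α) (hc : 0 < c) {c' m m' : ℝ} (h : m ^ 2 + c ≤ m' ^ 2 + c') :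
    gain β α c' m' ≤ gain β α c m := by
  refine mul_le_mul_of_nonneg_left
    (Real.rpow_le_rpow_of_nonpos (by positivity) ?_ (by linarith)) hβ.le
  exact Real.sqrt_le_sqrt h

lemma gain_strictAntiOn (hβ : 0 < β) (hα : 0 < α) (hc : 0 < c) :
    StrictAntiOn (gain β α c) (Ici 0) := by
  intro m hm m' _ h
  have : m ^ 2 < m' ^ 2 := pow_lt_pow_left₀ h hm (by norm_num)
  exact gain_lt hβ hα hc (by linarith)

lemma hasDerivAt_gain (hc : 0 < c) (m : ℝ) :
    HasDerivAt (gain β α c)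
      (-(β * α * Real.sqrt (m ^ 2 + c) ^ (-α - 1) * (m / Real.sqrt (m ^ 2 + c)))) m := by
  have hpos : 0 < m ^ 2 + c := by positivity
  have h1 : HasDerivAt (fun m : ℝ => m ^ 2 + c) (2 * m) m := by
    simpa using (hasDerivAt_pow 2 m).add_const c
  have h2 := ((h1.sqrt hpos.ne').rpow_const (p := -α)
    (Or.inl (Real.sqrt_pos.2 hpos).ne')).const_mul β
  refine h2.congr_deriv ?_
  field_simp

end Gain

namespace Channel

variable {T : Terrain} (C : Channel T)

lemma sq_Hu_pos : 0 < (C.Hd - C.Hu) ^ 2 := pow_pos (sub_pos.2 C.Hu_lt) 2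

lemma sq_Hb_pos : 0 < (C.Hd - C.Hb) ^ 2 := pow_pos (sub_pos.2 C.Hb_lt) 2

lemma guSeg_eq_gain (k : ℕ) (x : Plane) :
    C.guSeg k x = gain (C.β k) (C.α k) ((C.Hd - C.Hu) ^ 2) ‖x - T.xu‖ := rfl

lemma gb_eq_gain (x : Plane) :
    C.gb x = gain (C.β 0) (C.α 0) ((C.Hd - C.Hb) ^ 2) ‖x - T.xb‖ := rfl

lemma guSeg_pos_eq (k : ℕ) (ρ θ : ℝ) :
    C.guSeg k (T.pos ρ θ) = gain (C.β k) (C.α k) ((C.Hd - C.Hu) ^ 2) ρ := by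
  rw [guSeg_eq_gain, gain, gain, T.norm_pos_sub_xu]

lemma gb_pos_eq (ρ θ : ℝ) :
    C.gb (T.pos ρ θ) = gain (C.β 0) (C.α 0) ((T.L * Real.sin θ) ^ 2 + (C.Hd - C.Hb) ^ 2)
      (T.L * Real.cos θ - ρ) := by
  rw [gb_eq_gain, gain, gain, T.norm_pos_sub_xb, add_assoc]

variable {k : ℕ}

lemma α_pos (hk : k ≤ T.K) : 0 < C.α k := one_pos.trans (C.one_lt_α k hk)

lemma guSeg_pos (hk : k ≤ T.K) (x : Plane) : 0 < C.guSeg k x :=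
  gain_pos (C.β_pos k hk) C.sq_Hu_pos _

lemma gb_pos (x : Plane) : 0 < C.gb x := gain_pos (C.β_pos 0 (Nat.zero_le _)) C.sq_Hb_pos _

lemma contDiff_guSeg {n : WithTop ℕ∞} (k : ℕ) : ContDiff ℝ n (C.guSeg k) := by
  have h (x : Plane) : 0 < ‖x - T.xu‖ ^ 2 + (C.Hd - C.Hu) ^ 2 :=
    add_pos_of_nonneg_of_pos (by positivity) C.sq_Hu_pos
  refine contDiff_const.mul (ContDiff.rpow_const_of_ne (ContDiff.sqrt ?_ fun x => (h x).ne')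
    fun x => (Real.sqrt_pos.2 (h x)).ne')
  exact ((contDiff_id.sub contDiff_const).norm_sq ℝ).add contDiff_const

lemma contDiff_gb {n : WithTop ℕ∞} : ContDiff ℝ n C.gb := by
  have h (x : Plane) : 0 < ‖x - T.xb‖ ^ 2 + (C.Hd - C.Hb) ^ 2 :=
    add_pos_of_nonneg_of_pos (by positivity) C.sq_Hb_pos
  refine contDiff_const.mul (ContDiff.rpow_const_of_ne (ContDiff.sqrt ?_ fun x => (h x).ne')
    fun x => (Real.sqrt_pos.2 (h x)).ne')
  exact ((contDiff_id.sub contDiff_const).norm_sq ℝ).add contDiff_const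

lemma guSeg_le {j : ℕ} (hj : 1 ≤ j) (hjk : j ≤ k) (hk : k ≤ T.K) (x : Plane) :
    C.guSeg k x ≤ C.guSeg j x := by
  induction k, hjk using Nat.le_induction with
  | base => exact le_rfl
  | succ n hn ih =>
    exact (C.order (n + 1) (by omega) hk x).le.trans (ih (by omega))

lemma gb_lt_of_cos_lt {ρ θ θ' : ℝ} (hρ : 0 < ρ) (h : Real.cos θ' < Real.cos θ) :
    C.gb (T.pos ρ θ') < C.gb (T.pos ρ θ) := by
  have h1 := mul_lt_mul_of_pos_left h (mul_pos T.L_pos hρ)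
  have h2 : T.L ^ 2 * (Real.sin θ ^ 2 + Real.cos θ ^ 2) =
      T.L ^ 2 * (Real.sin θ' ^ 2 + Real.cos θ' ^ 2) := by
    rw [Real.sin_sq_add_cos_sq, Real.sin_sq_add_cos_sq]
  rw [gb_pos_eq, gb_pos_eq]
  refine gain_lt (C.β_pos 0 (Nat.zero_le _)) (C.α_pos (Nat.zero_le _))
    (add_pos_of_nonneg_of_pos (by positivity) C.sq_Hb_pos) ?_
  linarith

lemma gb_le_of_cos_le {ρ θ θ' : ℝ} (hρ : 0 ≤ ρ) (h : Real.cos θ' ≤ Real.cos θ) :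
    C.gb (T.pos ρ θ') ≤ C.gb (T.pos ρ θ) := by
  rcases hρ.eq_or_lt with rfl | hρ
  · simp
  have h1 := mul_le_mul_of_nonneg_left h (mul_pos T.L_pos hρ).le
  have h2 : T.L ^ 2 * (Real.sin θ ^ 2 + Real.cos θ ^ 2) =
      T.L ^ 2 * (Real.sin θ' ^ 2 + Real.cos θ' ^ 2) := by
    rw [Real.sin_sq_add_cos_sq, Real.sin_sq_add_cos_sq]
  rw [gb_pos_eq, gb_pos_eq]
  refine gain_le (C.β_pos 0 (Nat.zero_le _)) (C.α_pos (Nat.zero_le _))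
    (add_pos_of_nonneg_of_pos (by positivity) C.sq_Hb_pos) ?_
  linarith

/-- The channel gain of the base station increases along rays from the user, up to the circle with
the diameter from the user to the base station. -/
lemma gb_strictMonoOn (θ : ℝ) :
    StrictMonoOn (fun r => C.gb (T.pos r θ)) (Iic (T.L * Real.cos θ)) := by
  intro r _ r' hr' h
  simp only [gb_pos_eq]
  refine gain_strictAntiOn (C.β_pos 0 (Nat.zero_le _)) (C.α_pos (Nat.zero_le _))
    (add_pos_of_nonneg_of_pos (by positivity) C.sq_Hb_pos) ?_ ?_ (by linarith)
  · simpa using hr'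
  · exact sub_nonneg.2 (h.le.trans hr')

lemma guSeg_strictAntiOn (hk : k ≤ T.K) (θ : ℝ) :
    StrictAntiOn (fun r => C.guSeg k (T.pos r θ)) (Ici 0) := by
  intro r hr r' hr' h
  simp only [guSeg_pos_eq]
  exact gain_strictAntiOn (C.β_pos k hk) (C.α_pos hk) C.sq_Hu_pos hr hr' h

lemma gu_eq (x : Plane) : C.gu x = C.guSeg (T.seg x) x := by
  rw [gu, Finset.sum_ite_eq]
  simp [T.seg_mem x]

lemma cost_eq_total (f : ℝ → ℝ → ℝ) : C.cost f = T.total (C.segCost f) := by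
  ext x
  rw [T.total_eq, cost, segCost, gu_eq]

variable {f : ℝ → ℝ → ℝ}

lemma segCost_le (hf : ∀ y, 0 < y → AntitoneOn (fun x => f x y) (Ioi 0)) {j : ℕ} (hj : 1 ≤ j)
    (hjk : j ≤ k) (hk : k ≤ T.K) (x : Plane) : C.segCost f j x ≤ C.segCost f k x :=
  hf _ (C.gb_pos x) (C.guSeg_pos hk x) (C.guSeg_pos (hjk.trans hk) x) (C.guSeg_le hj hjk hk x)

lemma segCost_angular_le (hf : ∀ x, 0 < x → AntitoneOn (fun y => f x y) (Ioi 0)) (hk : k ≤ T.K)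
    {ρ θ θ' : ℝ} (hρ : 0 ≤ ρ) (h : Real.cos θ' ≤ Real.cos θ) :
    T.F (C.segCost f) k ρ θ ≤ T.F (C.segCost f) k ρ θ' := by
  simp only [Terrain.F, segCost, guSeg_pos_eq]
  exact hf _ (gain_pos (C.β_pos k hk) C.sq_Hu_pos _) (C.gb_pos _) (C.gb_pos _)
    (C.gb_le_of_cos_le hρ h)

/-- If the cost decreases in each of the channel gains, then a global minimizer can be moved
towards the user into the disc with the diameter from the user to the base station. -/
lemma exists_polar_minimizer (hfx : ∀ y, 0 < y → AntitoneOn (fun x => f x y) (Ioi 0))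
    (hfy : ∀ x, 0 < x → AntitoneOn (fun y => f x y) (Ioi 0))
    (hopt : ∃ x, ∀ y, C.cost f x ≤ C.cost f y) :
    ∃ ρ θ : ℝ, 0 ≤ ρ ∧ ρ ≤ T.L * Real.cos θ ∧ |θ| ≤ Real.pi / 2 ∧
      ∀ y, T.total (C.segCost f) (T.pos ρ θ) ≤ T.total (C.segCost f) y := by
  obtain ⟨x, hx⟩ := hopt
  obtain ⟨ρ, θ, hρ, hθ, hθ', rfl⟩ := T.exists_eq_pos x
  -- Moving towards the user improves the user's link, with no more obstruction, and does not worsen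
  -- the station's link if the distance to the foot `L cos θ` does not grow. The radii used below
  -- are `ρ`, `L cos θ` and `0`.
  have key : ∀ ρ', 0 ≤ ρ' → ρ' ≤ ρ →
      (T.L * Real.cos θ - ρ') ^ 2 ≤ (T.L * Real.cos θ - ρ) ^ 2 →
      ∀ y, T.total (C.segCost f) (T.pos ρ' θ) ≤ T.total (C.segCost f) y := by
    intro ρ' h0 h1 h2 y
    rw [← C.cost_eq_total]
    refine le_trans ?_ (hx y)
    have hseg := T.seg_mem (T.pos ρ θ)
    have hseg' := T.seg_mem (T.pos ρ' θ)
    have h3 : C.gu (T.pos ρ θ) ≤ C.gu (T.pos ρ' θ) := by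
      rw [gu_eq, gu_eq]
      refine le_trans ?_ (C.guSeg_le hseg'.1 (T.seg_pos_mono h0 h1 θ) hseg.2 _)
      exact (C.guSeg_strictAntiOn hseg.2 θ).antitoneOn h0 hρ h1
    have h4 : C.gb (T.pos ρ θ) ≤ C.gb (T.pos ρ' θ) := by
      rw [gb_pos_eq, gb_pos_eq]
      exact gain_le (C.β_pos 0 (Nat.zero_le _)) (C.α_pos (Nat.zero_le _))
        (add_pos_of_nonneg_of_pos (by positivity) C.sq_Hb_pos) (by linarith)
    have hgu (x : Plane) : 0 < C.gu x := by
      rw [gu_eq]; exact C.guSeg_pos (T.seg_mem x).2 x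
    exact (hfx _ (C.gb_pos _) (hgu _) (hgu _) h3).trans (hfy _ (hgu _) (C.gb_pos _) (C.gb_pos _) h4)
  have hL := T.L_pos
  by_cases hcos : 0 < Real.cos θ
  · have hθπ : |θ| ≤ Real.pi / 2 := by
      by_contra! hlt
      have := Real.cos_nonpos_of_pi_div_two_le_of_le hlt.le
        ((abs_le.2 ⟨hθ.le, hθ'⟩).trans (by linarith [Real.pi_pos]))
      rw [Real.cos_abs] at this
      linarith
    by_cases hle : ρ ≤ T.L * Real.cos θ
    · exact ⟨ρ, θ, hρ, hle, hθπ, key ρ hρ le_rfl le_rfl⟩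
    · refine ⟨T.L * Real.cos θ, θ, by positivity, le_rfl, hθπ,
        key _ (by positivity) (not_le.1 hle).le ?_⟩
      rw [sub_self, zero_pow two_ne_zero]
      positivity
  · refine ⟨0, 0, le_rfl, by simpa using hL.le, by simpa using Real.pi_div_two_pos.le, ?_⟩
    rw [T.pos_zero, ← T.pos_zero θ]
    refine key 0 le_rfl hρ ?_
    have := mul_nonneg (mul_nonneg hL.le hρ) (neg_nonneg.2 (not_lt.1 hcos))
    nlinarith [sq_nonneg ρ]

end Channel

/-- The side of the axis does not matter for the cosine of the deviation angle. -/
lemma cos_sign_mul {σ : ℝ} (hσ : σ = 1 ∨ σ = -1) (ψ : ℝ) : Real.cos (σ * ψ) = Real.cos ψ := by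
  rcases hσ with rfl | rfl <;> simp

/-! ### Costs of the first class -/

/-- If `x h'' + 2 h' ≥ 0` on the positive half-line, then `x² h'` is nondecreasing there. -/
lemma monotoneOn_sq_mul_deriv {h : ℝ → ℝ} (hd : ContDiffOn ℝ 2 h (Ioi 0))
    (hh : ∀ x, 0 < x → 0 ≤ x * deriv (deriv h) x + 2 * deriv h x) :
    MonotoneOn (fun x => x ^ 2 * deriv h x) (Ioi 0) := by
  have h1 : ContDiffOn ℝ 1 (deriv h) (Ioi 0) := hd.deriv_of_isOpen isOpen_Ioi (by norm_num)
  have h2 : ∀ x ∈ Ioi (0 : ℝ), HasDerivAt (fun x => x ^ 2 * deriv h x)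
      (x * (x * deriv (deriv h) x + 2 * deriv h x)) x := by
    intro x hx
    have h3 : HasDerivAt (deriv h) (deriv (deriv h) x) x :=
      ((h1.differentiableOn (by norm_num)).differentiableAt (Ioi_mem_nhds hx)).hasDerivAt
    refine ((hasDerivAt_pow 2 x).mul h3).congr_deriv ?_
    ring
  refine monotoneOn_of_deriv_nonneg (convex_Ioi 0)
    (fun x hx => (h2 x hx).continuousAt.continuousWithinAt) ?_ ?_
  · intro x hx
    rw [interior_Ioi] at hx
    exact (h2 x hx).differentiableAt.differentiableWithinAt
  · intro x hx
    rw [interior_Ioi] at hx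
    rw [(h2 x hx).deriv]
    exact mul_nonneg (le_of_lt hx) (hh x hx)

/-- If `deriv h x` were nonnegative, monotonicity of `x² h'` would keep the derivative nonnegative
beyond `x`, and `h` could not be strictly decreasing. -/
lemma deriv_neg_of_monotoneOn {h : ℝ → ℝ} (hd : ContDiffOn ℝ 2 h (Ioi 0))
    (ha : StrictAntiOn h (Ioi 0)) (hm : MonotoneOn (fun x => x ^ 2 * deriv h x) (Ioi 0))
    {x : ℝ} (hx : 0 < x) : deriv h x < 0 := by
  by_contra! hcon
  have hsub : Ici x ⊆ Ioi (0 : ℝ) := fun y hy => hx.trans_le hy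
  have hmono : MonotoneOn h (Ici x) := by
    refine monotoneOn_of_deriv_nonneg (convex_Ici x) (hd.continuousOn.mono hsub) ?_ ?_
    · exact (hd.differentiableOn (by norm_num)).mono (interior_subset.trans hsub)
    · intro y hy
      rw [interior_Ici] at hy
      have h1 := hm hx (hsub (Ioi_subset_Ici_self hy)) (le_of_lt hy)
      have h2 : 0 ≤ y ^ 2 * deriv h y := (mul_nonneg (sq_nonneg x) hcon).trans h1
      exact nonneg_of_mul_nonneg_right h2 (pow_pos (hx.trans hy) 2)
  have h3 := hmono self_mem_Ici (show x + 1 ∈ Ici x from by simp) (by linarith)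
  exact (ha hx (show (0 : ℝ) < x + 1 by linarith) (by linarith)).not_ge h3

/-- A function of the first admissible class is a sum of functions of either variable. -/
lemma Condition1.eq_add {f : ℝ → ℝ → ℝ} (hf : Condition1 f) {x y : ℝ} (hx : 0 < x) (hy : 0 < y) :
    f x y = f x 1 + (f 1 y - f 1 1) := by
  obtain ⟨hd, -, -, h⟩ := hf
  have hopen : IsOpen (Ioi (0 : ℝ) ×ˢ Ioi (0 : ℝ)) := isOpen_Ioi.prod isOpen_Ioi
  have hD : ∀ x y : ℝ, 0 < x → 0 < y → HasDerivAt (fun x' => f x' y)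
      (fderiv ℝ (fun p : ℝ × ℝ => f p.1 p.2) (x, y) (1, 0)) x := by
    intro x y hx hy
    have h1 : HasFDerivAt (fun p : ℝ × ℝ => f p.1 p.2)
        (fderiv ℝ (fun p : ℝ × ℝ => f p.1 p.2) (x, y)) (x, y) :=
      ((hd.differentiableOn (by norm_num)).differentiableAt
        (hopen.mem_nhds (mk_mem_prod hx hy))).hasFDerivAt
    exact h1.comp_hasDerivAt x ((hasDerivAt_id x).prodMk (hasDerivAt_const x y))
  -- The vanishing mixed derivative makes `f_x` independent of `y`; then `f x y - f x 1` does not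
  -- depend on `x`.
  have hconst : ∀ x y : ℝ, 0 < x → 0 < y →
      deriv (fun x' => f x' y) x = deriv (fun x' => f x' 1) x := by
    intro x y hx hy
    refine isOpen_Ioi.is_const_of_deriv_eq_zero isPreconnected_Ioi
      (f := fun y' => deriv (fun x' => f x' y') x) ?_ (fun y' hy' => (h x y' hx hy').1) hy
      (mem_Ioi.2 one_pos)
    have h1 : DifferentiableOn ℝ
        (fun y' => fderiv ℝ (fun p : ℝ × ℝ => f p.1 p.2) (x, y') (1, 0)) (Ioi 0) := by
      have h2 := (hd.fderiv_of_isOpen hopen (m := 1) (by norm_num)).differentiableOn (by norm_num)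
      have h3 : DifferentiableOn ℝ
          (fun y' => fderiv ℝ (fun p : ℝ × ℝ => f p.1 p.2) (x, y')) (Ioi 0) :=
        h2.comp (g := fderiv ℝ (fun p : ℝ × ℝ => f p.1 p.2)) (f := fun y' : ℝ => (x, y'))
          (by fun_prop) (fun y' hy' => mk_mem_prod hx hy')
      exact h3.clm_apply (differentiableOn_const _)
    exact h1.congr fun y' hy' => (hD x y' hx hy').deriv
  have key := isOpen_Ioi.is_const_of_deriv_eq_zero isPreconnected_Ioi
      (f := fun x' => f x' y - f x' 1)
      (fun x' hx' => ((hD x' y hx' hy).sub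
        (hD x' 1 hx' one_pos)).differentiableAt.differentiableWithinAt)
      (fun x' hx' => by
        have h1 := (hD x' y hx' hy).sub (hD x' 1 hx' one_pos)
        rw [← (hD x' y hx' hy).deriv, ← (hD x' 1 hx' one_pos).deriv, hconst x' y hx' hy,
          sub_self] at h1
        exact h1.deriv) hx (mem_Ioi.2 one_pos)
  linarith

section GainComp

variable {h : ℝ → ℝ} {β α c : ℝ}

/-- The derivative of `h ∘ gain β α c`, if `h` is differentiable. -/
def gainDeriv (h : ℝ → ℝ) (β α c m : ℝ) : ℝ :=
  -(gain β α c m ^ 2 * deriv h (gain β α c m)) * (α / β * Real.sqrt (m ^ 2 + c) ^ (α - 1)) *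
    (m / Real.sqrt (m ^ 2 + c))

/-- The chain rule, regrouped so that the monotone quantity `g² h'(g)` appears: with `s` the
distance, `g = β s ^ (-α)`, so extracting `g²` turns the power `-α - 1` of `s` into `α - 1`. -/
lemma hasDerivAt_comp_gain (hd : DifferentiableOn ℝ h (Ioi 0)) (hβ : 0 < β) (hc : 0 < c) (m : ℝ) :
    HasDerivAt (fun m => h (gain β α c m)) (gainDeriv h β α c m) m := by
  have h1 : HasDerivAt h (deriv h (gain β α c m)) (gain β α c m) :=
    (hd.differentiableAt (Ioi_mem_nhds (gain_pos hβ hc m))).hasDerivAt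
  refine (h1.comp m (hasDerivAt_gain hc m)).congr_deriv ?_
  have hs : 0 < Real.sqrt (m ^ 2 + c) := by positivity
  have h2 : gain β α c m ^ 2 * Real.sqrt (m ^ 2 + c) ^ (α - 1) =
      β ^ 2 * Real.sqrt (m ^ 2 + c) ^ (-α - 1) := by
    rw [gain, mul_pow, mul_assoc, ← Real.rpow_mul_natCast hs.le, ← Real.rpow_add hs]
    congr 2
    push_cast
    ring
  have h3 : gainDeriv h β α c m = -(deriv h (gain β α c m)) * (α / β) *
      (gain β α c m ^ 2 * Real.sqrt (m ^ 2 + c) ^ (α - 1)) * (m / Real.sqrt (m ^ 2 + c)) := by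
    rw [gainDeriv]; ring
  rw [h3, h2]
  field_simp

/-- A product of three nondecreasing factors: `-g² h'(g)`, since `g` decreases with `m`; a power of
the distance with exponent `α - 1 > 0`; and the sine `m / √(m² + c)`. The last is strictly
increasing and the other two are positive. -/
lemma strictMonoOn_gainDeriv (hneg : ∀ x, 0 < x → deriv h x < 0)
    (hm : MonotoneOn (fun x => x ^ 2 * deriv h x) (Ioi 0)) (hβ : 0 < β) (hα : 1 < α)
    (hc : 0 < c) : StrictMonoOn (gainDeriv h β α c) (Ici 0) := by
  intro m hm0 m' hm0' hlt
  rw [mem_Ici] at hm0 hm0'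
  have hsq : m ^ 2 < m' ^ 2 := pow_lt_pow_left₀ hlt hm0 (by norm_num)
  have hs : 0 < Real.sqrt (m ^ 2 + c) := by positivity
  have hs' : 0 < Real.sqrt (m' ^ 2 + c) := by positivity
  have hg := gain_pos (α := α) hβ hc m
  have hg' := gain_pos (α := α) hβ hc m'
  have hα0 : 0 < α := by linarith
  have h1 : -(gain β α c m ^ 2 * deriv h (gain β α c m)) ≤
      -(gain β α c m' ^ 2 * deriv h (gain β α c m')) :=
    neg_le_neg (hm hg' hg ((gain_strictAntiOn hβ hα0 hc).antitoneOn hm0 hm0' hlt.le))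
  have h2 : Real.sqrt (m ^ 2 + c) ^ (α - 1) ≤ Real.sqrt (m' ^ 2 + c) ^ (α - 1) :=
    Real.rpow_le_rpow hs.le (Real.sqrt_le_sqrt (by linarith)) (by linarith)
  have h3 : m / Real.sqrt (m ^ 2 + c) < m' / Real.sqrt (m' ^ 2 + c) := by
    rw [div_lt_div_iff₀ hs hs']
    refine lt_of_pow_lt_pow_left₀ 2 (by positivity) ?_
    rw [mul_pow, mul_pow, Real.sq_sqrt (by positivity), Real.sq_sqrt (by positivity)]
    nlinarith
  have h4 : 0 < -(gain β α c m ^ 2 * deriv h (gain β α c m)) := by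
    have := mul_pos (pow_pos hg 2) (neg_pos.2 (hneg _ hg))
    linarith
  have h5 : 0 < α / β * Real.sqrt (m ^ 2 + c) ^ (α - 1) := by positivity
  have h6 : α / β * Real.sqrt (m ^ 2 + c) ^ (α - 1) ≤ α / β * Real.sqrt (m' ^ 2 + c) ^ (α - 1) :=
    mul_le_mul_of_nonneg_left h2 (by positivity)
  exact mul_lt_mul_of_nonneg_of_pos' (mul_le_mul h1 h6 h5.le (h4.le.trans h1)) h3
    (div_nonneg hm0 hs.le) (mul_pos (h4.trans_le h1) (h5.trans_le h6))

end GainComp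

section SmoothCondition

variable {f : ℝ → ℝ → ℝ} {T : Terrain} {k : ℕ}

lemma Condition1.contDiff_segCost (hf : Condition1 f) (C : Channel T) (hk : k ≤ T.K) :
    ContDiff ℝ 1 (C.segCost f k) := by
  have h1 : ContDiff ℝ 1 (fun x => (C.guSeg k x, C.gb x)) :=
    (C.contDiff_guSeg k).prodMk C.contDiff_gb
  rw [← contDiffOn_univ]
  exact (hf.1.of_le (by norm_num)).comp h1.contDiffOn
    fun x _ => mk_mem_prod (C.guSeg_pos hk x) (C.gb_pos x)

/-- Between the user and the foot `L cos θ` both summands have strictly increasing derivatives in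
`r`, so once the radial derivative is nonnegative it is positive further out. -/
lemma Condition1.strictMonoOn (hf : Condition1 f) (C : Channel T) (hk : k ≤ T.K) {ρ θ : ℝ}
    (hρ : 0 ≤ ρ) (hder : 0 ≤ T.Fρ (C.segCost f) k ρ θ) :
    StrictMonoOn (fun r => T.F (C.segCost f) k r θ) (Icc ρ (T.L * Real.cos θ)) := by
  set a : ℝ → ℝ := fun x => f x 1 with ha
  set b : ℝ → ℝ := fun y => f 1 y with hb
  have hda : ContDiffOn ℝ 2 a (Ioi 0) :=
    hf.1.comp (contDiff_id.prodMk contDiff_const).contDiffOn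
      fun x hx => mk_mem_prod hx (mem_Ioi.2 one_pos)
  have hdb : ContDiffOn ℝ 2 b (Ioi 0) :=
    hf.1.comp (contDiff_const.prodMk contDiff_id).contDiffOn
      fun x hx => mk_mem_prod (mem_Ioi.2 one_pos) hx
  have hma := monotoneOn_sq_mul_deriv hda fun x hx => (hf.2.2.2 x 1 hx one_pos).2.1
  have hmb := monotoneOn_sq_mul_deriv hdb fun y hy => (hf.2.2.2 1 y one_pos hy).2.2
  have hna := fun x => deriv_neg_of_monotoneOn (x := x) hda (hf.2.1 1 one_pos) hma
  have hnb := fun x => deriv_neg_of_monotoneOn (x := x) hdb (hf.2.2.1 1 one_pos) hmb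
  have hcu := C.sq_Hu_pos
  have hcb : 0 < (T.L * Real.sin θ) ^ 2 + (C.Hd - C.Hb) ^ 2 :=
    add_pos_of_nonneg_of_pos (by positivity) C.sq_Hb_pos
  -- The station's term depends on `L cos θ - r`, which reverses both the sign and the direction of
  -- monotonicity of its derivative; `d` is thus strictly increasing in `r` up to `L cos θ`.
  set d : ℝ → ℝ := fun r => gainDeriv a (C.β k) (C.α k) ((C.Hd - C.Hu) ^ 2) r -
    gainDeriv b (C.β 0) (C.α 0) ((T.L * Real.sin θ) ^ 2 + (C.Hd - C.Hb) ^ 2)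
      (T.L * Real.cos θ - r) with hd
  have hF : (fun r => T.F (C.segCost f) k r θ) = fun r =>
      a (gain (C.β k) (C.α k) ((C.Hd - C.Hu) ^ 2) r) +
      (b (gain (C.β 0) (C.α 0) ((T.L * Real.sin θ) ^ 2 + (C.Hd - C.Hb) ^ 2)
        (T.L * Real.cos θ - r)) - f 1 1) := by
    ext r
    rw [Terrain.F, Channel.segCost, hf.eq_add (C.guSeg_pos hk _) (C.gb_pos _), C.guSeg_pos_eq,
      C.gb_pos_eq]
  have hderiv : ∀ r, HasDerivAt (fun r => T.F (C.segCost f) k r θ) (d r) r := by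
    intro r
    rw [hF]
    have h1 := hasDerivAt_comp_gain (α := C.α k) (hda.differentiableOn (by norm_num))
      (C.β_pos k hk) hcu r
    have h2 := hasDerivAt_comp_gain (α := C.α 0) (hdb.differentiableOn (by norm_num))
      (C.β_pos 0 (Nat.zero_le _)) hcb (T.L * Real.cos θ - r)
    have h3 := h2.comp r ((hasDerivAt_id r).const_sub (T.L * Real.cos θ))
    refine (h1.add (h3.sub_const (f 1 1))).congr_deriv ?_
    rw [hd]
    ring
  have hdρ : 0 ≤ d ρ := by
    have : T.Fρ (C.segCost f) k ρ θ = d ρ :=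
      (hderiv ρ).hasDerivWithinAt.derivWithin (uniqueDiffWithinAt_Iic ρ)
    rwa [this] at hder
  refine strictMonoOn_of_deriv_pos (convex_Icc _ _)
    (fun r _ => (hderiv r).continuousAt.continuousWithinAt) fun r hr => ?_
  rw [interior_Icc] at hr
  rw [(hderiv r).deriv]
  refine hdρ.trans_lt ?_
  have h1 := strictMonoOn_gainDeriv hna hma (C.β_pos k hk) (C.one_lt_α k hk) hcu
    (show ρ ∈ Ici 0 from hρ) (show r ∈ Ici 0 from hρ.trans hr.1.le) hr.1
  have h2 := strictMonoOn_gainDeriv hnb hmb (C.β_pos 0 (Nat.zero_le _))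
    (C.one_lt_α 0 (Nat.zero_le _)) hcb
    (show T.L * Real.cos θ - r ∈ Ici 0 from by simpa using hr.2.le)
    (show T.L * Real.cos θ - ρ ∈ Ici 0 from by simpa using (hr.1.trans hr.2).le)
    (by linarith [hr.1])
  simp only [hd]
  linarith

lemma Condition1.isRegular (hf : Condition1 f) (C : Channel T) (hk : k ≤ T.K) :
    IsRegular T (C.segCost f) k univ (C.segCost f k) := by
  refine isRegular_of_contDiff (hf.contDiff_segCost C hk)
    (fun ρ θ h0 _ _ h3 => hf.strictMonoOn C hk h0 h3) ?_
  intro σ hσ ρ ψ ψ' hρ h0 h1 h2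
  simp only [Terrain.F, Channel.segCost, C.guSeg_pos_eq]
  refine hf.2.2.1 _ (gain_pos (C.β_pos k hk) C.sq_Hu_pos _) (C.gb_pos _) (C.gb_pos _)
    (C.gb_lt_of_cos_lt hρ ?_)
  rw [cos_sign_mul hσ, cos_sign_mul hσ]
  exact Real.cos_lt_cos_of_nonneg_of_le_pi h0 (by linarith [Real.pi_pos]) h1

end SmoothCondition

lemma strictAntiOn_of_deriv_neg_Ioi {h : ℝ → ℝ}
    (hh : ∀ x, 0 < x → DifferentiableAt ℝ h x ∧ deriv h x < 0) : StrictAntiOn h (Ioi 0) :=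
  strictAntiOn_of_deriv_neg (convex_Ioi 0)
    (fun x hx => (hh x hx).1.continuousAt.continuousWithinAt)
    fun x hx => (hh x (interior_subset hx)).2

lemma Condition1.antitoneOn {f : ℝ → ℝ → ℝ} (hf : Condition1 f) :
    (∀ y, 0 < y → AntitoneOn (fun x => f x y) (Ioi 0)) ∧
      ∀ x, 0 < x → AntitoneOn (fun y => f x y) (Ioi 0) :=
  ⟨fun y hy => (hf.2.1 y hy).antitoneOn, fun x hx => (hf.2.2.1 x hx).antitoneOn⟩

lemma Condition2.antitoneOn {f : ℝ → ℝ → ℝ} (hf : Condition2 f) :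
    (∀ y, 0 < y → AntitoneOn (fun x => f x y) (Ioi 0)) ∧
      ∀ x, 0 < x → AntitoneOn (fun y => f x y) (Ioi 0) := by
  obtain ⟨f₁, f₂, h₁, h₂, h⟩ := hf
  refine ⟨fun y hy x hx x' hx' hle => ?_, fun x hx y hy y' hy' hle => ?_⟩
  · simp only [h x y hx hy, h x' y hx' hy]
    exact max_le_max_right _ ((strictAntiOn_of_deriv_neg_Ioi h₁).antitoneOn hx hx' hle)
  · simp only [h x y hx hy, h x y' hx hy']
    exact max_le_max_left _ ((strictAntiOn_of_deriv_neg_Ioi h₂).antitoneOn hy hy' hle)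

/-! ### Costs of the second class -/

section MaxCost

variable {f : ℝ → ℝ → ℝ} {f₁ f₂ : ℝ → ℝ} {T : Terrain} {k : ℕ}

lemma segCost_eq_max (h : ∀ x y, 0 < x → 0 < y → f x y = max (f₁ x) (f₂ y)) (C : Channel T)
    (hk : k ≤ T.K) (x : Plane) :
    C.segCost f k x = max (f₁ (C.guSeg k x)) (f₂ (C.gb x)) :=
  h _ _ (C.guSeg_pos hk x) (C.gb_pos x)

lemma continuous_userCost (h₁ : ∀ x, 0 < x → DifferentiableAt ℝ f₁ x ∧ deriv f₁ x < 0)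
    (C : Channel T) (hk : k ≤ T.K) : Continuous fun x => f₁ (C.guSeg k x) :=
  continuous_iff_continuousAt.2 fun x =>
    (h₁ _ (C.guSeg_pos hk x)).1.continuousAt.comp
      (C.contDiff_guSeg (n := 0) k).continuous.continuousAt

lemma continuous_stationCost (h₂ : ∀ y, 0 < y → DifferentiableAt ℝ f₂ y ∧ deriv f₂ y < 0)
    (C : Channel T) : Continuous fun x => f₂ (C.gb x) :=
  continuous_iff_continuousAt.2 fun x =>
    (h₂ _ (C.gb_pos x)).1.continuousAt.comp (C.contDiff_gb (n := 0)).continuous.continuousAt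

lemma strictMonoOn_userCost (h₁ : ∀ x, 0 < x → DifferentiableAt ℝ f₁ x ∧ deriv f₁ x < 0)
    (C : Channel T) (hk : k ≤ T.K) (θ : ℝ) :
    StrictMonoOn (fun r => f₁ (C.guSeg k (T.pos r θ))) (Ici 0) := fun _ hr _ hr' hlt =>
  strictAntiOn_of_deriv_neg_Ioi h₁ (C.guSeg_pos hk _) (C.guSeg_pos hk _)
    (C.guSeg_strictAntiOn hk θ hr hr' hlt)

lemma strictAntiOn_stationCost (h₂ : ∀ y, 0 < y → DifferentiableAt ℝ f₂ y ∧ deriv f₂ y < 0)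
    (C : Channel T) (θ : ℝ) :
    StrictAntiOn (fun r => f₂ (C.gb (T.pos r θ))) (Iic (T.L * Real.cos θ)) := fun _ hr _ hr' hlt =>
  strictAntiOn_of_deriv_neg_Ioi h₂ (C.gb_pos _) (C.gb_pos _) (C.gb_strictMonoOn θ hr hr' hlt)

/-- The derivative of the channel gain of the base station in polar coordinates. -/
def gbDeriv (C : Channel T) (ρ θ : ℝ) : ℝ × ℝ →L[ℝ] ℝ :=
  fderiv ℝ (fun p : ℝ × ℝ => C.gb (T.pos p.1 p.2)) (ρ, θ)

lemma hasFDerivAt_gb (C : Channel T) (ρ θ : ℝ) :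
    HasFDerivAt (fun p : ℝ × ℝ => C.gb (T.pos p.1 p.2)) (gbDeriv C ρ θ) (ρ, θ) :=
  (((C.contDiff_gb (n := 1)).comp T.contDiff_pos).differentiable (by norm_num) _).hasFDerivAt

lemma hasDerivAt_gb_radial (C : Channel T) (ρ θ : ℝ) :
    HasDerivAt (fun r => C.gb (T.pos r θ)) (gbDeriv C ρ θ (1, 0)) ρ :=
  (hasFDerivAt_gb C ρ θ).comp_hasDerivAt (f := fun r => (r, θ)) ρ
    ((hasDerivAt_id ρ).prodMk (hasDerivAt_const ρ θ))

lemma hasDerivAt_gb_angular (C : Channel T) (ρ θ : ℝ) :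
    HasDerivAt (fun t => C.gb (T.pos ρ t)) (gbDeriv C ρ θ (0, 1)) θ :=
  (hasFDerivAt_gb C ρ θ).comp_hasDerivAt (f := fun t => (ρ, t)) θ
    ((hasDerivAt_const θ ρ).prodMk (hasDerivAt_id θ))

lemma gbDeriv_radial_pos (C : Channel T) {ρ θ : ℝ} (hρ : ρ < T.L * Real.cos θ) :
    0 < gbDeriv C ρ θ (1, 0) := by
  have hβ := C.β_pos 0 (Nat.zero_le _)
  have hα := C.α_pos (k := 0) (Nat.zero_le _)
  have hcb : 0 < (T.L * Real.sin θ) ^ 2 + (C.Hd - C.Hb) ^ 2 :=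
    add_pos_of_nonneg_of_pos (by positivity) C.sq_Hb_pos
  have hm : 0 < T.L * Real.cos θ - ρ := sub_pos.2 hρ
  have h1 := (hasDerivAt_gain (β := C.β 0) (α := C.α 0) hcb (T.L * Real.cos θ - ρ)).comp ρ
    ((hasDerivAt_id ρ).const_sub (T.L * Real.cos θ))
  have h2 := hasDerivAt_gb_radial C ρ θ
  simp only [C.gb_pos_eq] at h2
  rw [h2.unique h1, mul_neg_one, neg_neg]
  positivity

lemma gbDeriv_angular_nonpos (C : Channel T) {ρ θ : ℝ} (hρ : 0 ≤ ρ) (h0 : 0 < θ)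
    (hθ : θ < Real.pi / 2) : gbDeriv C ρ θ (0, 1) ≤ 0 := by
  have hanti : AntitoneOn (fun t => C.gb (T.pos ρ t)) (Icc 0 Real.pi) := fun t ht t' ht' hle =>
    C.gb_le_of_cos_le hρ (Real.cos_le_cos_of_nonneg_of_le_pi ht.1 ht'.2 hle)
  have := hanti.derivWithin_nonpos (x := θ)
  have hmem : Icc 0 Real.pi ∈ 𝓝 θ := Icc_mem_nhds h0 (by linarith [Real.pi_pos])
  rwa [derivWithin_of_mem_nhds hmem, (hasDerivAt_gb_angular C ρ θ).deriv] at this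

lemma Fρ_eq_of_le (h₂ : ∀ y, 0 < y → DifferentiableAt ℝ f₂ y ∧ deriv f₂ y < 0)
    (h : ∀ x y, 0 < x → 0 < y → f x y = max (f₁ x) (f₂ y)) (C : Channel T)
    (hk : k ≤ T.K)
    {ρ θ : ℝ}
    (hev : ∀ᶠ r in 𝓝[≤] ρ, f₁ (C.guSeg k (T.pos r θ)) ≤ f₂ (C.gb (T.pos r θ))) :
    T.Fρ (C.segCost f) k ρ θ = deriv f₂ (C.gb (T.pos ρ θ)) * gbDeriv C ρ θ (1, 0) := by
  have h3 : (fun r => T.F (C.segCost f) k r θ) =ᶠ[𝓝[≤] ρ] fun r => f₂ (C.gb (T.pos r θ)) := by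
    filter_upwards [hev] with r hr
    rw [Terrain.F, segCost_eq_max h C hk, max_eq_right hr]
  rw [Terrain.Fρ, h3.derivWithin_eq (h3.eq_of_nhdsWithin self_mem_Iic)]
  exact ((h₂ _ (C.gb_pos (T.pos ρ θ))).1.hasDerivAt.comp ρ
    (hasDerivAt_gb_radial C ρ θ)).hasDerivWithinAt.derivWithin (uniqueDiffWithinAt_Iic ρ)

lemma Fθ_eq_of_le (h₂ : ∀ y, 0 < y → DifferentiableAt ℝ f₂ y ∧ deriv f₂ y < 0)
    (h : ∀ x y, 0 < x → 0 < y → f x y = max (f₁ x) (f₂ y)) (C : Channel T)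
    (hk : k ≤ T.K)
    {ρ θ : ℝ}
    (hev : ∀ᶠ t in 𝓝[≤] θ, f₁ (C.guSeg k (T.pos ρ t)) ≤ f₂ (C.gb (T.pos ρ t))) :
    T.Fθ (C.segCost f) k ρ θ = deriv f₂ (C.gb (T.pos ρ θ)) * gbDeriv C ρ θ (0, 1) := by
  have h3 : (fun t => T.F (C.segCost f) k ρ t) =ᶠ[𝓝[≤] θ] fun t => f₂ (C.gb (T.pos ρ t)) := by
    filter_upwards [hev] with t ht
    rw [Terrain.F, segCost_eq_max h C hk, max_eq_right ht]
  rw [Terrain.Fθ, h3.derivWithin_eq (h3.eq_of_nhdsWithin self_mem_Iic)]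
  exact ((h₂ _ (C.gb_pos (T.pos ρ θ))).1.hasDerivAt.comp θ
    (hasDerivAt_gb_angular C ρ θ)).hasDerivWithinAt.derivWithin (uniqueDiffWithinAt_Iic θ)

/-- Where the user's term dominates, the cost is locally that term, which grows with the distance
from the user. The search therefore runs only where the station's term is active. -/
lemma Fρ_nonneg_of_lt (h₁ : ∀ x, 0 < x → DifferentiableAt ℝ f₁ x ∧ deriv f₁ x < 0)
    (h₂ : ∀ y, 0 < y → DifferentiableAt ℝ f₂ y ∧ deriv f₂ y < 0)
    (h : ∀ x y, 0 < x → 0 < y → f x y = max (f₁ x) (f₂ y)) (C : Channel T)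
    (hk : k ≤ T.K)
    {ρ θ : ℝ} (hρ : 0 ≤ ρ)
    (hlt : f₂ (C.gb (T.pos ρ θ)) < f₁ (C.guSeg k (T.pos ρ θ))) :
    0 ≤ T.Fρ (C.segCost f) k ρ θ := by
  have hcont : Continuous fun r => T.pos r θ :=
    T.continuous_pos.comp (by fun_prop : Continuous fun r : ℝ => (r, θ))
  have hev : ∀ᶠ r in 𝓝[≤] ρ, f₂ (C.gb (T.pos r θ)) < f₁ (C.guSeg k (T.pos r θ)) :=
    (((continuous_stationCost h₂ C).comp hcont).continuousAt.eventually_lt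
      ((continuous_userCost h₁ C hk).comp hcont).continuousAt hlt).filter_mono nhdsWithin_le_nhds
  have h3 : (fun r => T.F (C.segCost f) k r θ) =ᶠ[𝓝[≤] ρ]
      fun r => f₁ (C.guSeg k (T.pos r θ)) := by
    filter_upwards [hev] with r hr
    rw [Terrain.F, segCost_eq_max h C hk, max_eq_left hr.le]
  have hgu := hasDerivAt_gain (β := C.β k) (α := C.α k) C.sq_Hu_pos ρ
  rw [← funext fun r => C.guSeg_pos_eq k r θ] at hgu
  have hd : HasDerivAt (fun r => f₁ (C.guSeg k (T.pos r θ))) _ ρ :=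
    (h₁ _ (C.guSeg_pos hk (T.pos ρ θ))).1.hasDerivAt.comp ρ hgu
  rw [Terrain.Fρ, h3.derivWithin_eq (h3.eq_of_nhdsWithin self_mem_Iic),
    hd.hasDerivWithinAt.derivWithin (uniqueDiffWithinAt_Iic ρ)]
  have hβ := C.β_pos k hk
  have hα := C.α_pos hk
  refine mul_nonneg_of_nonpos_of_nonpos (h₁ _ (C.guSeg_pos hk _)).2.le (neg_nonpos.2 ?_)
  positivity

/-- On `E` the station's term is active, so the cost is a decreasing function of the smooth gain
`gb`. Once the user's term is active, it remains so radially up to `L cos θ` and the cost increases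
there. The delicate points are ties, where the one-sided derivatives of the maximum may come from
different terms. -/
lemma isRegular_of_eq_max (h₁ : ∀ x, 0 < x → DifferentiableAt ℝ f₁ x ∧ deriv f₁ x < 0)
    (h₂ : ∀ y, 0 < y → DifferentiableAt ℝ f₂ y ∧ deriv f₂ y < 0)
    (h : ∀ x y, 0 < x → 0 < y → f x y = max (f₁ x) (f₂ y)) (C : Channel T)
    (hk : k ≤ T.K) :
    IsRegular T (C.segCost f) k {x | f₁ (C.guSeg k x) ≤ f₂ (C.gb x)} (fun x => -C.gb x) where
  continuous := by
    have : C.segCost f k = fun x => max (f₁ (C.guSeg k x)) (f₂ (C.gb x)) :=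
      funext fun x => segCost_eq_max h C hk x
    rw [this]
    exact (continuous_userCost h₁ C hk).max (continuous_stationCost h₂ C)
  isClosed := isClosed_le (continuous_userCost h₁ C hk) (continuous_stationCost h₂ C)
  mem_of_running ρ θ hρ _ hns := by
    by_contra hcon
    exact hns (Or.inr (Fρ_nonneg_of_lt h₁ h₂ h C hk hρ (not_le.1 hcon)))
  strictMonoOn ρ θ hρ hθ hρL hfreq := by
    have hge : f₂ (C.gb (T.pos ρ θ)) ≤ f₁ (C.guSeg k (T.pos ρ θ)) := by
      by_contra! hlt
      refine hfreq ?_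
      have hA : ContinuousAt (fun p : ℝ × ℝ => f₁ (C.guSeg k (T.pos p.1 p.2))) (ρ, θ) :=
        ((continuous_userCost h₁ C hk).comp T.continuous_pos).continuousAt
      have hB : ContinuousAt (fun p : ℝ × ℝ => f₂ (C.gb (T.pos p.1 p.2))) (ρ, θ) :=
        ((continuous_stationCost h₂ C).comp T.continuous_pos).continuousAt
      have hev1 := hA.eventually_lt hB hlt
      have hev2 : ∀ᶠ p : ℝ × ℝ in 𝓝 (ρ, θ), p.1 < T.L * Real.cos p.2 :=
        (by fun_prop : ContinuousAt (fun p : ℝ × ℝ => p.1) (ρ, θ)).eventually_lt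
          (by fun_prop : ContinuousAt (fun p : ℝ × ℝ => T.L * Real.cos p.2) (ρ, θ)) hρL
      filter_upwards [hev1, hev2] with p hp1 hp2
      have hcont : Continuous fun r => T.pos r p.2 :=
        T.continuous_pos.comp (by fun_prop : Continuous fun r : ℝ => (r, p.2))
      have hev : ∀ᶠ r in 𝓝[≤] p.1, f₁ (C.guSeg k (T.pos r p.2)) ≤ f₂ (C.gb (T.pos r p.2)) :=
        ((((continuous_userCost h₁ C hk).comp hcont).continuousAt.eventually_lt
          ((continuous_stationCost h₂ C).comp hcont).continuousAt hp1).filter_mono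
            nhdsWithin_le_nhds).mono fun r hr => le_of_lt hr
      rw [not_le, Fρ_eq_of_le h₂ h C hk hev]
      exact mul_neg_of_neg_of_pos (h₂ _ (C.gb_pos _)).2 (gbDeriv_radial_pos C hp2)
    have hmono := strictMonoOn_userCost h₁ C hk θ
    have hF : ∀ r ∈ Icc ρ (T.L * Real.cos θ),
        T.F (C.segCost f) k r θ = f₁ (C.guSeg k (T.pos r θ)) := by
      intro r hr
      rw [Terrain.F, segCost_eq_max h C hk, max_eq_left]
      exact ((strictAntiOn_stationCost h₂ C θ).antitoneOn hρL.le hr.2 hr.1).trans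
        (hge.trans (hmono.monotoneOn hρ (hρ.trans hr.1) hr.1))
    intro r hr r' hr' hlt
    simp only [hF r hr, hF r' hr']
    exact hmono (hρ.trans hr.1) (hρ.trans hr'.1) hlt
  angular_le σ hσ ρ ψ ψ' hρ h0 h3 h4 := by
    refine C.segCost_angular_le (Condition2.antitoneOn ⟨f₁, f₂, h₁, h₂, h⟩).2 hk hρ ?_
    rw [cos_sign_mul hσ, cos_sign_mul hσ]
    exact Real.cos_le_cos_of_nonneg_of_le_pi h0 (by linarith [Real.pi_pos]) h3
  angular_lt σ hσ ρ ψ ψ' hρ h0 h3 h4 hE := by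
    rw [Terrain.F, Terrain.F, segCost_eq_max h C hk, segCost_eq_max h C hk, max_eq_right hE]
    refine lt_max_of_lt_right (strictAntiOn_of_deriv_neg_Ioi h₂ (C.gb_pos _) (C.gb_pos _)
      (C.gb_lt_of_cos_lt hρ ?_))
    rw [cos_sign_mul hσ, cos_sign_mul hσ]
    exact Real.cos_lt_cos_of_nonneg_of_le_pi h0 (by linarith [Real.pi_pos]) h3
  contDiff := C.contDiff_gb.neg
  le_of_le x hx y hy hxy := by
    rw [segCost_eq_max h C hk, segCost_eq_max h C hk, max_eq_right hx, max_eq_right hy]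
    exact (strictAntiOn_of_deriv_neg_Ioi h₂).antitoneOn (C.gb_pos _) (C.gb_pos _)
      (neg_le_neg_iff.1 hxy)
  contour κ σ hσ ρ θ hρ hθ hσθ hns w hw := by
    obtain ⟨hw1, hw2, hw3, -⟩ := hw
    have hf : fderiv ℝ (fun p : ℝ × ℝ => -C.gb (T.pos p.1 p.2)) (ρ, θ) = -gbDeriv C ρ θ :=
      (hasFDerivAt_gb C ρ θ).neg.fderiv
    have hw' : w = w.1 • ((1 : ℝ), (0 : ℝ)) + w.2 • ((0 : ℝ), (1 : ℝ)) := by ext <;> simp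
    have hgoal : fderiv ℝ (fun p : ℝ × ℝ => -C.gb (T.pos p.1 p.2)) (ρ, θ) w =
        -(gbDeriv C ρ θ (1, 0) * w.1 + gbDeriv C ρ θ (0, 1) * w.2) := by
      rw [hf]
      conv_lhs => rw [hw']
      rw [map_add, map_smul, map_smul]
      simp only [_root_.neg_apply, smul_eq_mul]
      ring
    rw [hgoal]
    have hE : f₁ (C.guSeg k (T.pos ρ θ)) ≤ f₂ (C.gb (T.pos ρ θ)) := by
      by_contra hcon
      exact hns (Or.inr (Fρ_nonneg_of_lt h₁ h₂ h C hk hρ (not_le.1 hcon)))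
    simp only [Terrain.Stop, not_or, not_le] at hns
    obtain ⟨hρL, hFρ⟩ := hns
    have hf2 := (h₂ _ (C.gb_pos (T.pos ρ θ))).2
    -- At the user's position polar coordinates degenerate: angular derivatives vanish and the
    -- contour equation forces zero radial velocity.
    rcases hρ.eq_or_lt with rfl | hρ0
    · have h3 : T.Fθ (C.segCost f) k 0 θ = 0 := by
        simp [Terrain.Fθ, Terrain.F]
      have h4 : gbDeriv C 0 θ (0, 1) = 0 := by
        have := hasDerivAt_gb_angular C 0 θ
        simp only [T.pos_zero] at this
        exact this.unique (hasDerivAt_const θ _)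
      rw [h3, zero_mul, add_zero, mul_eq_zero] at hw3
      rw [h4, hw3.resolve_left hFρ.ne]
      simp
    have hcontr : Continuous fun r => T.pos r θ :=
      T.continuous_pos.comp (by fun_prop : Continuous fun r : ℝ => (r, θ))
    have hcontt : Continuous fun t => T.pos ρ t :=
      T.continuous_pos.comp (by fun_prop : Continuous fun t : ℝ => (ρ, t))
    -- If both left derivatives are those of `f₂ ∘ gb`, the contour equation is a nonzero multiple
    -- of the statement that `gb` is stationary along `w`.
    have key : T.Fθ (C.segCost f) k ρ θ = deriv f₂ (C.gb (T.pos ρ θ)) * gbDeriv C ρ θ (0, 1) →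
        T.Fρ (C.segCost f) k ρ θ = deriv f₂ (C.gb (T.pos ρ θ)) * gbDeriv C ρ θ (1, 0) →
        0 ≤ -(gbDeriv C ρ θ (1, 0) * w.1 + gbDeriv C ρ θ (0, 1) * w.2) := by
      intro h3 h4
      rw [h3, h4, mul_assoc, mul_assoc, ← mul_add, mul_eq_zero] at hw3
      rw [hw3.resolve_left hf2.ne, neg_zero]
    rcases hE.lt_or_eq with hlt | heq
    · refine key (Fθ_eq_of_le h₂ h C hk ?_) (Fρ_eq_of_le h₂ h C hk ?_)
      · exact ((((continuous_userCost h₁ C hk).comp hcontt).continuousAt.eventually_lt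
          ((continuous_stationCost h₂ C).comp hcontt).continuousAt hlt).filter_mono
            nhdsWithin_le_nhds).mono fun r hr => le_of_lt hr
      · exact ((((continuous_userCost h₁ C hk).comp hcontr).continuousAt.eventually_lt
          ((continuous_stationCost h₂ C).comp hcontr).continuousAt hlt).filter_mono
            nhdsWithin_le_nhds).mono fun r hr => le_of_lt hr
    -- At a tie, moving inward lowers the user's term and raises the station's, so the left radial
    -- derivative comes from the station's term.
    · have hFρ' : T.Fρ (C.segCost f) k ρ θ =
          deriv f₂ (C.gb (T.pos ρ θ)) * gbDeriv C ρ θ (1, 0) := by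
        refine Fρ_eq_of_le h₂ h C hk ?_
        filter_upwards [mem_nhdsWithin_of_mem_nhds (Ioi_mem_nhds hρ0), self_mem_nhdsWithin]
          with r hr0 hr
        have h3 := (strictMonoOn_userCost h₁ C hk θ).monotoneOn (Ioi_subset_Ici_self hr0) hρ hr
        have h4 := (strictAntiOn_stationCost h₂ C θ).antitoneOn
          (show r ∈ Iic _ from (mem_Iic.1 hr).trans hρL.le) hρL.le hr
        exact h3.trans (heq.le.trans h4)
      have hanti := (strictAntiOn_of_deriv_neg_Ioi h₂).antitoneOn
      have hgu : ∀ t, C.guSeg k (T.pos ρ t) = C.guSeg k (T.pos ρ θ) := fun t => by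
        rw [C.guSeg_pos_eq, C.guSeg_pos_eq]
      -- For `θ > 0`, smaller angles are closer to the axis, so from the left the maximum is the
      -- user's term, constant in the angle. Then `Fθ = 0`, the velocity is purely angular, and `gb`
      -- does not increase. For `θ ≤ 0`, smaller angles are farther from the axis, the station's
      -- term is active, and `key` applies.
      rcases lt_or_ge 0 θ with hθ0 | hθ0
      · have hσ1 : σ = 1 := hσ.resolve_right (by rintro rfl; linarith)
        have h3 : T.Fθ (C.segCost f) k ρ θ = 0 := by
          have h4 : (fun t => T.F (C.segCost f) k ρ t) =ᶠ[𝓝[≤] θ]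
              fun _ => f₁ (C.guSeg k (T.pos ρ θ)) := by
            filter_upwards [mem_nhdsWithin_of_mem_nhds (Ioi_mem_nhds hθ0), self_mem_nhdsWithin]
              with t ht0 ht
            rw [Terrain.F, segCost_eq_max h C hk, hgu, max_eq_left]
            rw [heq]
            refine hanti (C.gb_pos _) (C.gb_pos _) (C.gb_le_of_cos_le hρ ?_)
            exact Real.cos_le_cos_of_nonneg_of_le_pi (le_of_lt ht0)
              (by linarith [(abs_lt.1 hθ).2, Real.pi_pos]) ht
          rw [Terrain.Fθ, h4.derivWithin_eq (h4.eq_of_nhdsWithin self_mem_Iic)]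
          simp
        rw [h3, zero_mul, add_zero, mul_eq_zero] at hw3
        rw [hw3.resolve_left hFρ.ne, mul_zero, zero_add, neg_nonneg]
        rw [hσ1, one_mul] at hw2
        exact mul_nonpos_of_nonpos_of_nonneg
          (gbDeriv_angular_nonpos C hρ hθ0 (abs_lt.1 hθ).2) hw2
      · refine key (Fθ_eq_of_le h₂ h C hk ?_) hFρ'
        filter_upwards [mem_nhdsWithin_of_mem_nhds (Ioi_mem_nhds (abs_lt.1 hθ).1),
          self_mem_nhdsWithin] with t ht0 ht
        rw [hgu, heq]
        refine hanti (C.gb_pos _) (C.gb_pos _) (C.gb_le_of_cos_le hρ ?_)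
        rw [← Real.cos_neg t, ← Real.cos_neg θ]
        have ht' : t ≤ θ := ht
        have ht0' : -(Real.pi / 2) < t := ht0
        exact Real.cos_le_cos_of_nonneg_of_le_pi (by linarith) (by linarith [Real.pi_pos])
          (by linarith)

end MaxCost

end UAV

end

theorem theorem1 :
    (∀ (T : UAV.Terrain) (C : UAV.Channel T) (f : ℝ → ℝ → ℝ) (κ : ℝ), 0 < κ →
      (UAV.Condition1 f ∨ UAV.Condition2 f) →
      (∃ x, ∀ y, C.cost f x ≤ C.cost f y) →
      ∀ R : UAV.Run, R.IsValid T (C.segCost f) κ →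
        R.ReachesOptimum T (C.segCost f) (C.cost f)) ∧
    (∀ (T : UAV.Terrain) (Φ : ℕ → UAV.Plane → ℝ) (κ : ℝ), 0 < κ →
      (∀ k, 1 ≤ k → k ≤ T.K → ContDiff ℝ 1 (Φ k)) →
      (∀ j k, 1 ≤ j → j ≤ k → k ≤ T.K → ∀ x, Φ j x ≤ Φ k x) →
      (∀ k, 1 ≤ k → k ≤ T.K → UAV.UniqueRadialMin T Φ k) →
      (∀ k, 1 ≤ k → k ≤ T.K → UAV.AngularMono T Φ k) →
      (∃ ρ θ : ℝ, 0 ≤ ρ ∧ ρ ≤ T.L * Real.cos θ ∧ |θ| ≤ Real.pi / 2 ∧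
        ∀ y, T.total Φ (T.pos ρ θ) ≤ T.total Φ y) →
      ∀ R : UAV.Run, R.IsValid T Φ κ → R.ReachesOptimum T Φ (T.total Φ)) := by
  refine ⟨fun T C f κ hκ hf hopt R hR => ?_, fun T Φ κ hκ hΦ hord hu ha hopt R hR => ?_⟩
  · have hanti : (∀ y, 0 < y → AntitoneOn (fun x => f x y) (Ioi 0)) ∧
        ∀ x, 0 < x → AntitoneOn (fun y => f x y) (Ioi 0) :=
      hf.elim UAV.Condition1.antitoneOn UAV.Condition2.antitoneOn
    rw [C.cost_eq_total]
    refine hR.reachesOptimum hκ (fun j k hj hjk hk x => C.segCost_le hanti.1 hj hjk hk x) ?_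
      (C.exists_polar_minimizer hanti.1 hanti.2 hopt)
    intro k _ hk
    rcases hf with hf | ⟨f₁, f₂, h₁, h₂, h⟩
    · exact ⟨_, _, hf.isRegular C hk⟩
    · exact ⟨_, _, UAV.isRegular_of_eq_max h₁ h₂ h C hk⟩
  · exact hR.reachesOptimum hκ hord (fun k hk hkK =>
      ⟨_, _, UAV.isRegular_of_uniqueRadialMin (hΦ k hk hkK) (hu k hk hkK) (ha k hk hkK)⟩) hopt
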